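/- **Setting.** Let $\mathcal V$ be an infinite set of variables, $\Lambda$ the set of $\lambda$-terms over $\mathcal V$, with $(v)u$ denoting the application of $v$ to $u$, and let $A$ be a non-empty set of atoms. A term respects the variable convention if every variable is bound at most once in it. *Machine.* Closures are pairs $(t,e)$ of a $\lambda$-term $t$ and an environment $e$, that is, a partial map with finite domain from variables to closures (built inductively from the empty environment $\emptyset$). A state is a non-empty finite sequence $c.\pi$ of closures; $\epsilon$ is the empty stack. Configurations are states, variables, applications $(k)k'$ and abstractions $\lambda y.k$ of configurations. The partial map $\succ_\beta$ on configurations is given by - $(x,e).\pi\succ_\beta e(x).\pi$ if $x\in\mathrm{dom}(e)$; - $((x,e),c_1,\dots,c_q)\succ_\beta (x)(c_1.\epsilon)\dots(c_q.\epsilon)$ if $x\notin\mathrm{dom}(e)$; - $(\lambda x.u,e).(c.\pi)\succ_\beta (u,\{(x,c)\}\cup e).\pi$, and $(\lambda x.u,e).\epsilon\succ_\beta\lambda x.((u,e).\epsilon)$; - $((v)u,e).\pi\succ_\beta (v,e).((u,e).\pi)$; - no step from a variable; $(k_1)k_2\succ_\beta (k_1')k_2$ if $k_1\succ_\beta k_1'$;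 $(k_1)k_2\succ_\beta (k_1)k_2'$ if there is no step from $k_1$ and $k_2\succ_\beta k_2'$; $\lambda y.k\succ_\beta\lambda y.k'$ if $k\succ_\beta k'$. $l_\beta(k)\in\mathbb N\cup\{\infty\}$ is the number of steps from $k$ until no step is possible, and $\infty$ if this never happens. *Types.* $D$ is the least set with $D=A\,\dot\cup\,(\mathcal M_{\rm fin}(D)\times D)$, where $\mathcal M_{\rm fin}$ denotes finite multisets and $[\,]$ is the empty one. $D^{\rm ex}$ and $\overline{D^{\rm ex}}$ are the least subsets of $D$ with $D^{\rm ex}=A\cup(\mathcal M_{\rm fin}(\overline{D^{\rm ex}})\times D^{\rm ex})$ and $\overline{D^{\rm ex}}=A\cup((\mathcal M_{\rm fin}(D^{\rm ex})\setminus\{[\,]\})\times\overline{D^{\rm ex}})$. A context is a map $\Gamma:\mathcal V\to\mathcal M_{\rm fin}(D)$ equal to $[\,]$ outside a finite set; contexts are added pointwise; $\Phi^{\rm ex}$ is the set of contexts with values in $\mathcal M_{\rm fin}(\overline{D^{\rm ex}})$. The rules of System $R$ are: $x:[\alpha]\vdash x:\alpha$; from $\Gamma,x:a\vdash v:\alpha$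 (where $\Gamma(x)=[\,]$) infer $\Gamma\vdash\lambda x.v:(a,\alpha)$; from $\Gamma_0\vdash v:([\alpha_1,\dots,\alpha_n],\alpha)$ and $\Gamma_i\vdash u:\alpha_i$ for $1\le i\le n$ ($n\ge 0$) infer $\Gamma_0+\Gamma_1+\dots+\Gamma_n\vdash (v)u:\alpha$. The size $|\Pi|$ of a derivation $\Pi$ is its number of nodes, and $\Delta^{\rm ex}(t)$ is the set of all derivations of judgements $\Gamma\vdash t:\alpha$ with $(\Gamma,\alpha)\in\Phi^{\rm ex}\times D^{\rm ex}$. *1-typings.* Write $a_1\dots a_m\alpha$ for $(a_1,(a_2,\dots(a_m,\alpha)))$. The 1-typings of normal terms are derived by: $x:[\gamma]\vdash_1 x:\gamma$ for $\gamma\in A$; from $\Gamma,x:a\vdash_1 t:\alpha$ (where $\Gamma(x)=[\,]$) infer $\Gamma\vdash_1\lambda x.t:(a,\alpha)$; from $\Gamma_i\vdash_1 u_i:\alpha_i$ for $1\le i\le n$ infer $\sum_i\Gamma_i+x:[[\alpha_1]\dots[\alpha_n]\gamma]\vdash_1 (x)u_1\dots u_n:\gamma$ for $\gamma\in A$. A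 1-typing of a normalizable term (one that has a $\beta$-normal form) is a 1-typing of its normal form. **Theorem.** Let $t$ be a $\lambda$-term, and let $t'$ be any term that is $\alpha$-equivalent to $t$ and respects the variable convention (for instance $t'=t$ if $t$ does). Then $$l_\beta((t',\emptyset).\epsilon)=\inf\{|\Pi| : \Pi\in\Delta^{\rm ex}(t)\}\in\mathbb N\cup\{\infty\}.$$ If $t$ is not normalizable, both sides are $\infty$. If $t$ is normalizable, then $t$ has a 1-typing, and for every 1-typing $(\Gamma,\alpha)$ of $t$ we have $(\Gamma,\alpha)\in\Phi^{\rm ex}\times D^{\rm ex}$, the judgement $\Gamma\vdash t:\alpha$ is derivable in System $R$, and each of its derivations has size exactly $l_\beta((t',\emptyset).\epsilon)$. -/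

import Mathlib

namespace LambdaR

universe u v

/-! ### λ-terms, substitution, α-equivalence and β-reduction -/

/-- λ-terms over the set of variables `V`; `app v u` is the application `(v)u`. -/
inductive Term (V : Type u) : Type u
  | var (x : V) : Term V
  | app (v u : Term V) : Term V
  | lam (x : V) (u : Term V) : Term V

namespace Term

variable {V : Type u}

/-- The free variables of a λ-term. -/
def fv [DecidableEq V] : Term V → Finset V
  | var x => {x}
  | app v u => fv v ∪ fv u
  | lam x u => (fv u).erase x

/-- The bound variables of a λ-term, listed once for each binder. -/
def binders : Term V → List V
  | var _ => []
  | app v u => binders v ++ binders u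
  | lam x u => x :: binders u

/-- The variable convention: any variable is bound at most once in the term. -/
def RespectsConvention (t : Term V) : Prop := t.binders.Nodup

/-- `(t) u₁ … uₙ`. -/
def appList (t : Term V) (us : List (Term V)) : Term V := us.foldl app t

/-- A variable outside a given finite set. -/
noncomputable def fresh [Infinite V] (s : Finset V) : V :=
  (Infinite.exists_notMem_finset s).choose

/-- Capture-avoiding simultaneous substitution: the bound variable of every abstraction is
renamed to one that is fresh for all the terms that are substituted in its body. -/
noncomputable def substAll [DecidableEq V] [Infinite V] : Term V → (V → Term V) → Term V
  | var x, σ => σ x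
  | app v u, σ => app (v.substAll σ) (u.substAll σ)
  | lam x u, σ =>
      let y := fresh ((lam x u).fv.biUnion fun z => (σ z).fv)
      lam y (u.substAll (Function.update σ x (var y)))

/-- `u[v/x]`. -/
noncomputable def subst [DecidableEq V] [Infinite V] (u : Term V) (x : V) (v : Term V) : Term V :=
  u.substAll (Function.update var x v)

/-- α-equivalence: the least congruence that relates `λx.u` to `λy.u[y/x]` for `y` not free
in `λx.u`. -/
inductive AlphaEq [DecidableEq V] [Infinite V] : Term V → Term V → Prop
  | rename (x y : V) (u : Term V) (h : y ∉ (lam x u).fv) :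
      AlphaEq (lam x u) (lam y (u.subst x (var y)))
  | refl (t : Term V) : AlphaEq t t
  | symm {t t' : Term V} : AlphaEq t t' → AlphaEq t' t
  | trans {t t' t'' : Term V} : AlphaEq t t' → AlphaEq t' t'' → AlphaEq t t''
  | app {v v' u u' : Term V} : AlphaEq v v' → AlphaEq u u' → AlphaEq (app v u) (app v' u')
  | lam (x : V) {u u' : Term V} : AlphaEq u u' → AlphaEq (lam x u) (lam x u')

/-- One step of β-reduction, at any position. -/
inductive Beta [DecidableEq V] [Infinite V] : Term V → Term V → Prop
  | redex (x : V) (u v : Term V) : Beta (app (lam x u) v) (u.subst x v)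
  | appLeft {v v' : Term V} (u : Term V) : Beta v v' → Beta (app v u) (app v' u)
  | appRight (v : Term V) {u u' : Term V} : Beta u u' → Beta (app v u) (app v u')
  | lam (x : V) {u u' : Term V} : Beta u u' → Beta (lam x u) (lam x u')

/-- `n` is a β-normal form of `t`. -/
def IsNormalFormOf [DecidableEq V] [Infinite V] (n t : Term V) : Prop :=
  Relation.ReflTransGen Beta t n ∧ ∀ n', ¬ Beta n n'

/-- `t` has a β-normal form. -/
def Normalizable [DecidableEq V] [Infinite V] (t : Term V) : Prop :=
  ∃ n, IsNormalFormOf n t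

end Term

/-! ### Krivine's machine for the β-normal form -/

/-- Closures `(t, e)`. The environment `e` is a partial map from variables to closures with
finite domain `dom` and values `val`. -/
inductive Closure (V : Type u) : Type u
  | mk (t : Term V) (dom : Finset V) (val : dom → Closure V) : Closure V

/-- Environments: partial maps from variables to closures, with finite domain. -/
structure Env (V : Type u) : Type u where
  dom : Finset V
  val : dom → Closure V

namespace Env

variable {V : Type u}

/-- The empty environment. -/
def empty : Env V := ⟨∅, fun x => absurd x.2 (Finset.notMem_empty _)⟩

/-- The value of the environment at `x`, if `x` is in its domain. -/
def lookup [DecidableEq V] (e : Env V) (x : V) : Option (Closure V) :=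
  if h : x ∈ e.dom then some (e.val ⟨x, h⟩) else none

/-- `{(x, c)} ∪ e`, for `x` outside the domain of `e`. -/
def extend [DecidableEq V] (e : Env V) (x : V) (c : Closure V) : Env V where
  dom := insert x e.dom
  val y := if h : (y : V) = x then c
    else e.val ⟨y, Finset.mem_of_mem_insert_of_ne y.2 h⟩

end Env

/-- The closure `(t, e)`. -/
def close {V : Type u} (t : Term V) (e : Env V) : Closure V := .mk t e.dom e.val

/-- States: non-empty stacks of closures, `c . π`. -/
abbrev State (V : Type u) : Type u := Closure V × List (Closure V)

/-- The partial map `s ≻ s'` from states to states. -/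
def stepState {V : Type u} [DecidableEq V] : State V → Option (State V)
  | (.mk (.var x) dom val, π) => ((Env.mk dom val).lookup x).map fun c => (c, π)
  | (.mk (.lam _ _) _ _, []) => none
  | (.mk (.lam x u) dom val, c :: π) => some (close u ((Env.mk dom val).extend x c), π)
  | (.mk (.app v u) dom val, π) => some (.mk v dom val, .mk u dom val :: π)

/-- Configurations of the machine: a state, or a variable, or an application or abstraction
built from configurations. Those that the machine reaches from a state have the form
`λx₁. … λxₘ. s` or `λx₁. … λxₘ. (x) k₁ … kₚ`, with `s` a state and `k₁, …, kₚ`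
again of one of these forms. -/
inductive Conf (V : Type u) : Type u
  | state (s : State V) : Conf V
  | var (x : V) : Conf V
  | app (v u : Conf V) : Conf V
  | lam (x : V) (k : Conf V) : Conf V

/-- What the machine does with a state at which `stepState` is not defined. A free variable is
put out together with its arguments, as `(x) (c₁ . ε) … (c_q . ε)`; the abstraction of
`(λx.u, e) . ε` is put out, as `λx. ((u, e) . ε)`. (The last case does not arise.) -/
def output {V : Type u} : State V → Option (Conf V)
  | (.mk (.var x) _ _, π) => some (π.foldl (fun k c => .app k (.state (c, []))) (.var x))
  | (.mk (.lam x u) dom val, _) => some (.lam x (.state (.mk u dom val, [])))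
  | (.mk (.app _ _) _ _, _) => none

/-- The partial map `k ≻_β k'` from configurations to configurations. In an application the
left part is executed until it is stuck, and then the argument. -/
def stepBeta {V : Type u} [DecidableEq V] : Conf V → Option (Conf V)
  | .state s =>
      match stepState s with
      | some s' => some (.state s')
      | none => output s
  | .var _ => none
  | .app v u =>
      match stepBeta v with
      | some v' => some (.app v' u)
      | none => (stepBeta u).map fun u' => .app v u'
  | .lam y k => (stepBeta k).map fun k' => .lam y k'

/-- From `k` the machine reaches, in exactly `n` steps, a configuration where it stops. -/
def HaltsIn {V : Type u} [DecidableEq V] (k : Conf V) (n : ℕ) : Prop :=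
  ∃ k', (fun o : Option (Conf V) => o.bind stepBeta)^[n] (some k) = some k' ∧ stepBeta k' = none

open Classical in
/-- `l_β(k)`: the number of steps of the machine started at `k`, or `∞` if it does not stop.
(The map is deterministic, so the number is unique if it exists.) -/
noncomputable def lBeta {V : Type u} [DecidableEq V] (k : Conf V) : ℕ∞ :=
  if h : ∃ n, HaltsIn k n then ((h.choose : ℕ) : ℕ∞) else ⊤

/-- The state `(t, ∅) . ε`. -/
def initial {V : Type u} (t : Term V) : Conf V := .state (close t Env.empty, [])

/-! ### Types: the set `D` with `D = A ⊔ (finite multisets of D) × D` -/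

/-- Types with finite sequences in place of finite multisets. -/
inductive PreTy (A : Type v) : Type v
  | atom (γ : A) : PreTy A
  | arrow (a : List (PreTy A)) (α : PreTy A) : PreTy A

/-- Equality up to the order of the sequences, at any depth: the least congruence that contains
the exchange of two neighbours. -/
inductive PreTy.Rel {A : Type v} : PreTy A → PreTy A → Prop
  | refl (α : PreTy A) : Rel α α
  | symm {α β : PreTy A} : Rel α β → Rel β α
  | trans {α β γ : PreTy A} : Rel α β → Rel β γ → Rel α γ
  | right (a : List (PreTy A)) {α β : PreTy A} : Rel α β → Rel (arrow a α) (arrow a β)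
  | cons {α α' : PreTy A} {a a' : List (PreTy A)} {β β' : PreTy A} :
      Rel α α' → Rel (arrow a β) (arrow a' β') → Rel (arrow (α :: a) β) (arrow (α' :: a') β')
  | swap (α α' : PreTy A) (a : List (PreTy A)) (β : PreTy A) :
      Rel (arrow (α :: α' :: a) β) (arrow (α' :: α :: a) β)

instance PreTy.setoid (A : Type v) : Setoid (PreTy A) where
  r := PreTy.Rel
  iseqv := ⟨PreTy.Rel.refl, PreTy.Rel.symm, PreTy.Rel.trans⟩

/-- The set `D` of types over the set of atoms `A`. -/
def Ty (A : Type v) : Type v := Quotient (PreTy.setoid A)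

namespace Ty

variable {A : Type v}

/-- The type that a representative stands for. -/
def mk (p : PreTy A) : Ty A := Quotient.mk (PreTy.setoid A) p

/-- A representative of a type. -/
noncomputable def out (α : Ty A) : PreTy A := Quotient.out (s := PreTy.setoid A) α

theorem mk_out (α : Ty A) : mk (out α) = α := Quotient.out_eq (s := PreTy.setoid A) α

theorem mk_eq {p q : PreTy A} (h : PreTy.Rel p q) : mk p = mk q :=
  Quotient.sound (s := PreTy.setoid A) h

theorem rel_out_mk (p : PreTy A) : PreTy.Rel p (out (mk p)) :=
  .symm (Quotient.mk_out (s := PreTy.setoid A) p)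

/-- The atoms, as types. -/
def atom (γ : A) : Ty A := mk (PreTy.atom γ)

/-- The type `(a, α)`. -/
noncomputable def arrow (a : Multiset (Ty A)) (α : Ty A) : Ty A :=
  mk (PreTy.arrow (a.toList.map out) (out α))

/-- The decomposition of a representative. -/
def destPre : PreTy A → A ⊕ (Multiset (Ty A) × Ty A)
  | .atom γ => Sum.inl γ
  | .arrow a α => Sum.inr (((a.map mk : List (Ty A)) : Multiset (Ty A)), mk α)

theorem destPre_eq {p q : PreTy A} (h : PreTy.Rel p q) : destPre p = destPre q := by
  induction h with
  | refl => rfl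
  | symm _ ih => exact ih.symm
  | trans _ _ ih1 ih2 => exact ih1.trans ih2
  | right a h _ => simp only [destPre, mk_eq h]
  | cons h1 _ _ ih2 =>
    simp only [destPre, Sum.inr.injEq, Prod.mk.injEq, List.map_cons, ← Multiset.cons_coe] at ih2 ⊢
    rw [ih2.1, mk_eq h1]
    exact ⟨rfl, ih2.2⟩
  | swap α α' a β =>
    simp only [destPre, Sum.inr.injEq, Prod.mk.injEq, List.map_cons, and_true,
      Multiset.coe_eq_coe]
    exact List.Perm.swap _ _ _

/-- The decomposition of a type. -/
def dest : Ty A → A ⊕ (Multiset (Ty A) × Ty A) :=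
  Quotient.lift (s := PreTy.setoid A) destPre fun _ _ h => destPre_eq h

theorem dest_atom (γ : A) : dest (atom γ) = Sum.inl γ := rfl

theorem dest_arrow (a : Multiset (Ty A)) (α : Ty A) : dest (arrow a α) = Sum.inr (a, α) := by
  have h : dest (arrow a α) = Sum.inr
      ((((a.toList.map out).map mk : List (Ty A)) : Multiset (Ty A)), mk (out α)) := rfl
  have e : (mk ∘ out : Ty A → Ty A) = id := funext mk_out
  rw [h, mk_out, List.map_map, e, List.map_id, Multiset.coe_toList]

theorem arrow_injective {a b : Multiset (Ty A)} {α β : Ty A} (h : arrow a α = arrow b β) :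
    a = b ∧ α = β := by
  have := congrArg dest h
  rw [dest_arrow, dest_arrow] at this
  simpa using this

theorem atom_injective {γ δ : A} (h : atom γ = atom δ) : γ = δ := by
  have := congrArg dest h
  rw [dest_atom, dest_atom] at this
  simpa using this

theorem atom_ne_arrow (γ : A) (a : Multiset (Ty A)) (α : Ty A) : atom γ ≠ arrow a α := by
  intro h
  have := congrArg dest h
  rw [dest_atom, dest_arrow] at this
  cases this

theorem rel_of_perm {l l' : List (Ty A)} (h : l.Perm l') (β : PreTy A) :
    PreTy.Rel (.arrow (l.map out) β) (.arrow (l'.map out) β) := by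
  induction h with
  | nil => exact .refl _
  | cons x _ ih => exact .cons (.refl _) ih
  | swap x y l => exact .swap _ _ _ _
  | trans _ _ ih1 ih2 => exact .trans ih1 ih2

theorem rel_map_out (l : List (PreTy A)) (β : PreTy A) :
    PreTy.Rel (.arrow l β) (.arrow ((l.map mk).map out) β) := by
  induction l with
  | nil => exact .refl _
  | cons p l ih => exact .cons (rel_out_mk p) ih

theorem mk_arrow (l : List (PreTy A)) (β : PreTy A) :
    mk (.arrow l β) = arrow ((l.map mk : List (Ty A)) : Multiset (Ty A)) (mk β) := by
  refine mk_eq (.trans (rel_map_out l β) (.trans (rel_of_perm ?_ β) (.right _ (rel_out_mk β))))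
  exact Multiset.coe_eq_coe.mp (Multiset.coe_toList _).symm

/-- Induction on types. Together with the injectivity of the two constructors and the
disjointness of their images, it says that `D` is the least solution of
`D = A ⊔ (finite multisets of D) × D`. -/
theorem induction {P : Ty A → Prop} (hatom : ∀ γ, P (atom γ))
    (harrow : ∀ a α, (∀ β ∈ a, P β) → P α → P (arrow a α)) (α : Ty A) : P α := by
  have key : ∀ p : PreTy A, P (mk p) := by
    intro p
    refine PreTy.rec (motive_1 := fun p => P (mk p)) (motive_2 := fun l => ∀ β ∈ l.map mk, P β)
      hatom ?_ ?_ ?_ p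
    · intro l β hl hβ
      rw [mk_arrow l β]
      exact harrow _ _ (fun γ hγ => hl γ (Multiset.mem_coe.mp hγ)) hβ
    · intro β hβ
      cases hβ
    · intro p l hp hl β hβ
      rw [List.map_cons, List.mem_cons] at hβ
      rcases hβ with rfl | hβ
      · exact hp
      · exact hl β hβ
  rw [← mk_out α]
  exact key _

/-- The type `a₁ … aₘ α`, that is `(a₁, (a₂, … (aₘ, α)))`. -/
noncomputable def arrows (l : List (Multiset (Ty A))) (α : Ty A) : Ty A := l.foldr arrow α

end Ty

mutual

/-- The set `D^ex`: the empty multiset has no positive occurrence in the type. -/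
inductive Dex {A : Type v} : Ty A → Prop
  | atom (γ : A) : Dex (Ty.atom γ)
  | arrow (a : Multiset (Ty A)) (α : Ty A) :
      (∀ β ∈ a, DexBar β) → Dex α → Dex (Ty.arrow a α)

/-- The dual set: the empty multiset has no negative occurrence in the type. -/
inductive DexBar {A : Type v} : Ty A → Prop
  | atom (γ : A) : DexBar (Ty.atom γ)
  | arrow (a : Multiset (Ty A)) (α : Ty A) :
      a ≠ 0 → (∀ β ∈ a, Dex β) → DexBar α → DexBar (Ty.arrow a α)

end

/-! ### System R -/

/-- The set `Φ` of contexts: maps from variables to finite multisets of types that are empty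
outside a finite set, with pointwise sum. -/
abbrev Ctx (V : Type u) (A : Type v) : Type (max u v) := V →₀ Multiset (Ty A)

/-- The set `Φ^ex`. -/
def PhiEx {V : Type u} {A : Type v} (Γ : Ctx V A) : Prop := ∀ x, ∀ β ∈ Γ x, DexBar β

/-- The derivations of `Γ ⊢ t : α` in System R. In the rule for abstractions the context of the
premise is `Γ.erase x, x : Γ x`. -/
inductive Deriv {V : Type u} {A : Type v} : Ctx V A → Term V → Ty A → Type (max u v)
  | var (x : V) (α : Ty A) : Deriv (Finsupp.single x {α}) (.var x) α
  | lam {Γ : Ctx V A} (x : V) {v : Term V} {α : Ty A} :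
      Deriv Γ v α → Deriv (Γ.erase x) (.lam x v) (Ty.arrow (Γ x) α)
  | app {n : ℕ} {Γ₀ : Ctx V A} (Γ : Fin n → Ctx V A) {v u : Term V} (αs : Fin n → Ty A)
      {α : Ty A} :
      Deriv Γ₀ v (Ty.arrow (Multiset.map αs Finset.univ.val) α) →
      (∀ i, Deriv (Γ i) u (αs i)) →
      Deriv (Γ₀ + ∑ i, Γ i) (.app v u) α

/-- The size of a derivation: the number of its nodes. -/
noncomputable def Deriv.size {V : Type u} {A : Type v} {Γ : Ctx V A} {t : Term V} {α : Ty A} :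
    Deriv Γ t α → ℕ
  | .var _ _ => 1
  | .lam _ d => d.size + 1
  | .app _ _ d ds => d.size + ∑ i, (ds i).size + 1

/-- The set of the sizes of the derivations of `Γ ⊢ t : α` with `(Γ, α) ∈ Φ^ex × D^ex`. -/
def sizesEx {V : Type u} (A : Type v) (t : Term V) : Set ℕ∞ :=
  {n | ∃ (Γ : Ctx V A) (α : Ty A) (d : Deriv Γ t α), PhiEx Γ ∧ Dex α ∧ n = (d.size : ℕ∞)}

/-- The rules that derive the 1-typings of normal λ-terms. -/
inductive OneTypingNF {V : Type u} {A : Type v} : Ctx V A → Term V → Ty A → Prop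
  | var (x : V) (γ : A) : OneTypingNF (Finsupp.single x {Ty.atom γ}) (.var x) (Ty.atom γ)
  | lam {Γ : Ctx V A} (x : V) {t : Term V} {α : Ty A} :
      OneTypingNF Γ t α → OneTypingNF (Γ.erase x) (.lam x t) (Ty.arrow (Γ x) α)
  | head {n : ℕ} (x : V) (us : Fin n → Term V) (Γ : Fin n → Ctx V A) (αs : Fin n → Ty A)
      (γ : A) :
      (∀ i, OneTypingNF (Γ i) (us i) (αs i)) →
      OneTypingNF
        (∑ i, Γ i +
          Finsupp.single x {Ty.arrows (List.ofFn fun i => {αs i}) (Ty.atom γ)})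
        (Term.appList (.var x) (List.ofFn us)) (Ty.atom γ)

/-- `(Γ, α)` is a 1-typing of the λ-term `t`: a 1-typing of its normal form. -/
def OneTyping {V : Type u} {A : Type v} [DecidableEq V] [Infinite V]
    (Γ : Ctx V A) (t : Term V) (α : Ty A) : Prop :=
  ∃ n, Term.IsNormalFormOf n t ∧ OneTypingNF Γ n α

end LambdaR

-- System R is quantitative: each machine step consumes exactly one node of a derivation. `sem`
-- reads a term as the set of its judgements with their sizes. `csem` does the same for a closure,
-- the declarations of variables in the environment being replaced by judgements of their values
-- (`Comp`). `ssem` treats a state as its head closure applied to the stack, without application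
-- nodes. A lookup then removes an axiom, a push an application node, a pop an abstraction node, and
-- context and type stay the same (`ssem_step`).
--
-- Putting out an abstraction costs its node, and putting out a free head variable costs its axiom.
-- If a judgement is in Φ^ex × D^ex, the type of a free head variable is in `DexBar`, so every
-- argument is typed at least once, again in Φ^ex × D^ex; a judgement of least size can be chosen
-- that types it exactly once. Hence the least size is the number of steps if the machine stops
-- (`Run.bounded_and_attained`), and a judgement in Φ^ex × D^ex forces it to stop because sizes
-- decrease (`exists_run_of_ssem`). Contracting a head redex also lowers sizes, so such a judgement
-- forces normalization (`Term.normalizable_of_sem`).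
--
-- For the 1-typings, a weight that depends on context and type only counts nodes of normal terms: a
-- negative atom is a variable, a negative arrow an application, a positive arrow an abstraction.
-- Among the judgements in Φ^ex × D^ex the least weight is the number of nodes of the final
-- configuration, and least weight implies least size (`Bounded`, `Attained`). A 1-typing has the
-- least weight among the judgements of the normal form (`OneTypingNF.spec`). Typability is
-- invariant under β in both directions (`typable_iff_of_beta`), so this weight is least for the
-- term itself, and every derivation of a 1-typing has the least size. The final configuration never
-- has to be identified with the normal form.

namespace LambdaR

universe u v w

variable {V : Type u} {A : Type v}

/-! ### Families of judgements indexed by finite multisets -/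

/-- `Bag P s Γ n`: every element `i` of the multiset `s` is given a context `Γᵢ` and a number `nᵢ`
with `P i Γᵢ nᵢ`; their sums are `Γ` and `n`. -/
inductive Bag {ι : Type w} (P : ι → Ctx V A → ℕ → Prop) : Multiset ι → Ctx V A → ℕ → Prop
  | zero : Bag P 0 0 0
  | cons {i : ι} {s : Multiset ι} {Γ Δ : Ctx V A} {n m : ℕ} :
      P i Γ n → Bag P s Δ m → Bag P (i ::ₘ s) (Γ + Δ) (n + m)

namespace Bag

variable {ι : Type w} {P Q : ι → Ctx V A → ℕ → Prop} {s t : Multiset ι} {i : ι}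
  {Γ : Ctx V A} {n : ℕ}

/-- A multiset has no last element, so the chosen `i` may sit deeper in the construction than its
last step; commutativity of the sums brings it to the front. -/
theorem exists_of_cons (h : Bag P t Γ n) :
    ∀ {i s}, t = i ::ₘ s → ∃ Γ₁ n₁ Γ₂ n₂,
      P i Γ₁ n₁ ∧ Bag P s Γ₂ n₂ ∧ Γ = Γ₁ + Γ₂ ∧ n = n₁ + n₂ := by
  induction h with
  | zero => intro i s h; exact absurd h.symm (Multiset.cons_ne_zero)
  | @cons j t Γ Δ n m hP hB ih =>
    intro i s h
    rcases Multiset.cons_eq_cons.mp h with ⟨rfl, rfl⟩ | ⟨_, r, rfl, rfl⟩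
    · exact ⟨_, _, _, _, hP, hB, rfl, rfl⟩
    · obtain ⟨Γ₁, n₁, Γ₂, n₂, h1, h2, rfl, rfl⟩ := ih rfl
      exact ⟨Γ₁, n₁, _, _, h1, .cons hP h2, by abel, by omega⟩

theorem cons_iff : Bag P (i ::ₘ s) Γ n ↔ ∃ Γ₁ n₁ Γ₂ n₂,
    P i Γ₁ n₁ ∧ Bag P s Γ₂ n₂ ∧ Γ = Γ₁ + Γ₂ ∧ n = n₁ + n₂ := by
  constructor
  · intro h; exact h.exists_of_cons rfl
  · rintro ⟨_, _, _, _, h1, h2, rfl, rfl⟩; exact .cons h1 h2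

theorem zero_iff : Bag P 0 Γ n ↔ Γ = 0 ∧ n = 0 := by
  constructor
  · intro h
    generalize ht : (0 : Multiset ι) = t at h
    cases h with
    | zero => exact ⟨rfl, rfl⟩
    | cons => exact absurd ht.symm Multiset.cons_ne_zero
  · rintro ⟨rfl, rfl⟩; exact .zero

theorem singleton_iff : Bag P {i} Γ n ↔ P i Γ n := by
  rw [← Multiset.cons_zero, cons_iff]
  constructor
  · rintro ⟨_, _, _, _, h1, h2, rfl, rfl⟩
    obtain ⟨rfl, rfl⟩ := zero_iff.mp h2
    simpa using h1
  · intro h; exact ⟨_, _, _, _, h, .zero, by simp, by simp⟩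

theorem add_iff : Bag P (s + t) Γ n ↔ ∃ Γ₁ n₁ Γ₂ n₂,
    Bag P s Γ₁ n₁ ∧ Bag P t Γ₂ n₂ ∧ Γ = Γ₁ + Γ₂ ∧ n = n₁ + n₂ := by
  induction s using Multiset.induction_on generalizing Γ n with
  | empty =>
    constructor
    · intro h; exact ⟨0, 0, Γ, n, .zero, by simpa using h, by simp, by simp⟩
    · rintro ⟨_, _, _, _, h1, h2, rfl, rfl⟩
      obtain ⟨rfl, rfl⟩ := zero_iff.mp h1
      simpa using h2
  | cons i s ih =>
    rw [Multiset.cons_add, cons_iff]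
    constructor
    · rintro ⟨_, _, _, _, h1, h2, rfl, rfl⟩
      obtain ⟨_, _, _, _, h3, h4, rfl, rfl⟩ := ih.mp h2
      exact ⟨_, _, _, _, .cons h1 h3, h4, by abel, by omega⟩
    · rintro ⟨_, _, _, _, h1, h2, rfl, rfl⟩
      obtain ⟨_, _, _, _, h3, h4, rfl, rfl⟩ := cons_iff.mp h1
      exact ⟨_, _, _, _, h3, ih.mpr ⟨_, _, _, _, h4, h2, rfl, rfl⟩, by abel, by omega⟩

theorem map_iff {κ : Type*} {f : κ → ι} {s : Multiset κ} :
    Bag P (s.map f) Γ n ↔ Bag (fun i => P (f i)) s Γ n := by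
  induction s using Multiset.induction_on generalizing Γ n with
  | empty => rw [Multiset.map_zero, zero_iff, zero_iff]
  | cons i s ih => simp only [Multiset.map_cons, cons_iff, ih]

theorem mono (h : Bag P s Γ n) (H : ∀ i ∈ s, ∀ Γ n, P i Γ n → Q i Γ n) : Bag Q s Γ n := by
  induction h with
  | zero => exact .zero
  | cons hP _ ih =>
    exact .cons (H _ (Multiset.mem_cons_self _ _) _ _ hP)
      (ih fun j hj => H j (Multiset.mem_cons_of_mem hj))

theorem congr (H : ∀ i ∈ s, ∀ Γ n, P i Γ n ↔ Q i Γ n) : Bag P s Γ n ↔ Bag Q s Γ n :=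
  ⟨fun h => h.mono fun i hi Γ n => (H i hi Γ n).mp, fun h => h.mono fun i hi Γ n => (H i hi Γ n).mpr⟩

/-- Change of the numbers of a family. -/
theorem exists_mono (h : Bag P s Γ n) (H : ∀ i Γ n, P i Γ n → ∃ m, Q i Γ m) :
    ∃ m, Bag Q s Γ m := by
  induction h with
  | zero => exact ⟨0, .zero⟩
  | cons hP _ ih =>
    obtain ⟨m, hm⟩ := ih
    obtain ⟨k, hk⟩ := H _ _ _ hP
    exact ⟨_, .cons hk hm⟩

/-- Each number of a family can be lowered by one. -/
theorem pred (hP : ∀ i Γ n, P i Γ n → 0 < n) :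
    Bag P s Γ n ↔ ∃ m, n = m + s.card ∧ Bag (fun i Γ n => P i Γ (n + 1)) s Γ m := by
  induction s using Multiset.induction_on generalizing Γ n with
  | empty => simp [zero_iff, and_comm]
  | cons i s ih =>
    simp only [cons_iff, ih, Multiset.card_cons]
    constructor
    · rintro ⟨Γ₁, n₁, Γ₂, n₂, h1, ⟨m, rfl, h2⟩, rfl, rfl⟩
      obtain ⟨k, rfl⟩ := Nat.exists_eq_add_of_lt (hP _ _ _ h1)
      exact ⟨k + m, by omega, _, _, _, _, by simpa using h1, h2, rfl, rfl⟩
    · rintro ⟨m, rfl, Γ₁, n₁, Γ₂, n₂, h1, h2, rfl, rfl⟩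
      exact ⟨_, _, _, _, h1, ⟨_, rfl, h2⟩, rfl, by omega⟩

theorem exists_support (h : Bag P s Γ n) {x : V} (hx : Γ x ≠ 0) :
    ∃ i ∈ s, ∃ Δ m, P i Δ m ∧ Δ x ≠ 0 := by
  induction h with
  | zero => exact absurd rfl hx
  | @cons i s Γ Δ n m hP _ ih =>
    by_cases h0 : Γ x = 0
    · obtain ⟨j, hj, r⟩ := ih (by simpa [h0] using hx)
      exact ⟨j, Multiset.mem_cons_of_mem hj, r⟩
    · exact ⟨i, Multiset.mem_cons_self _ _, Γ, n, hP, h0⟩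

theorem sum_finset {κ : Type*} [DecidableEq κ] (f : κ → ι) (Γ : κ → Ctx V A) (n : κ → ℕ)
    (H : ∀ i, P (f i) (Γ i) (n i)) (s : Finset κ) :
    Bag P (s.val.map f) (∑ i ∈ s, Γ i) (∑ i ∈ s, n i) := by
  induction s using Finset.induction_on with
  | empty => exact .zero
  | insert i s hi ih =>
    rw [Finset.sum_insert hi, Finset.sum_insert hi, Finset.insert_val_of_notMem hi,
      Multiset.map_cons]
    exact .cons (H i) ih

theorem exists_fin (h : Bag P s Γ n) : ∃ (k : ℕ) (f : Fin k → ι) (Δ : Fin k → Ctx V A)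
    (m : Fin k → ℕ), s = Multiset.map f Finset.univ.val ∧ Γ = ∑ i, Δ i ∧ n = ∑ i, m i ∧
      ∀ i, P (f i) (Δ i) (m i) := by
  induction h with
  | zero => exact ⟨0, Fin.elim0, Fin.elim0, Fin.elim0, rfl, rfl, rfl, fun i => i.elim0⟩
  | @cons i s Γ Δ n m hP _ ih =>
    obtain ⟨k, f, Δ, m, rfl, rfl, rfl, H⟩ := ih
    refine ⟨k + 1, Fin.cons i f, Fin.cons Γ Δ, Fin.cons n m, ?_, ?_, ?_, ?_⟩
    · rw [Fin.univ_succ]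
      simp
    · simp [Fin.sum_univ_succ]
    · simp [Fin.sum_univ_succ]
    · intro j
      refine Fin.cases ?_ (fun j => ?_) j
      · simpa using hP
      · simpa using H j

end Bag

/-! ### The semantics of terms -/

/-- Sets of judgements with a size. -/
abbrev Sem (V : Type u) (A : Type v) : Type (max u v) := Ty A → Ctx V A → ℕ → Prop

/-- `sem t α Γ n`: there is a derivation of `Γ ⊢ t : α` of size `n`. -/
def sem : Term V → Sem V A
  | .var x => fun α Γ n => Γ = Finsupp.single x {α} ∧ n = 1
  | .app v u => fun α Γ n => ∃ a Γ₁ n₁ Γ₂ n₂, sem v (Ty.arrow a α) Γ₁ n₁ ∧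
      Bag (sem u) a Γ₂ n₂ ∧ Γ = Γ₁ + Γ₂ ∧ n = n₁ + n₂ + 1
  | .lam x u => fun τ Γ n => ∃ α Γ' m, sem u α Γ' m ∧ τ = Ty.arrow (Γ' x) α ∧
      Γ = Γ'.erase x ∧ n = m + 1

theorem sem_pos {t : Term V} {α : Ty A} {Γ : Ctx V A} {n : ℕ} (h : sem t α Γ n) : 0 < n := by
  cases t with
  | var => obtain ⟨_, rfl⟩ := h; simp
  | app => obtain ⟨_, _, _, _, _, _, _, _, rfl⟩ := h; simp
  | lam => obtain ⟨_, _, _, _, _, _, rfl⟩ := h; simp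

theorem Deriv.sem_size {Γ : Ctx V A} {t : Term V} {α : Ty A} (d : Deriv Γ t α) :
    sem t α Γ d.size := by
  induction d with
  | var x α => exact ⟨rfl, rfl⟩
  | lam x d ih => exact ⟨_, _, _, ih, rfl, rfl, rfl⟩
  | app Γ αs d ds ih ihs =>
    exact ⟨_, _, _, _, _, ih, Bag.sum_finset αs Γ _ ihs Finset.univ, rfl, rfl⟩

/-- This permits the rest of the proof to use `sem`, where equations between contexts are hypotheses
and not indices, and premises are indexed by multisets instead of `Fin n`. -/
theorem sem_iff {t : Term V} {α : Ty A} {Γ : Ctx V A} {n : ℕ} :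
    sem t α Γ n ↔ ∃ d : Deriv Γ t α, d.size = n := by
  refine ⟨fun h => ?_, fun ⟨d, hd⟩ => hd ▸ d.sem_size⟩
  induction t generalizing α Γ n with
  | var x =>
    obtain ⟨rfl, rfl⟩ := h
    exact ⟨.var x α, rfl⟩
  | lam x u ih =>
    obtain ⟨α, Γ', m, hu, rfl, rfl, rfl⟩ := h
    obtain ⟨d, rfl⟩ := ih hu
    exact ⟨.lam x d, rfl⟩
  | app v u ihv ihu =>
    obtain ⟨a, Γ₁, n₁, Γ₂, n₂, hv, hu, rfl, rfl⟩ := h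
    obtain ⟨k, f, Δ, m, rfl, rfl, rfl, H⟩ := hu.exists_fin
    obtain ⟨d, rfl⟩ := ihv hv
    choose ds hds using fun i => ihu (H i)
    exact ⟨.app Δ f d ds, by simp [Deriv.size, hds]⟩

theorem sem_support [DecidableEq V] {t : Term V} {α : Ty A} {Γ : Ctx V A} {n : ℕ}
    (h : sem t α Γ n) {x : V} (hx : Γ x ≠ 0) : x ∈ t.fv := by
  induction t generalizing α Γ n with
  | var y =>
    obtain ⟨rfl, rfl⟩ := h
    by_contra hxy
    exact hx (Finsupp.single_eq_of_ne (by simpa [Term.fv] using hxy))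
  | lam y u ih =>
    obtain ⟨α, Γ', m, hu, rfl, rfl, rfl⟩ := h
    by_cases hxy : x = y
    · subst hxy; simp at hx
    · rw [Finsupp.erase_ne hxy] at hx
      exact Finset.mem_erase.mpr ⟨hxy, ih hu hx⟩
  | app v u ihv ihu =>
    obtain ⟨a, Γ₁, n₁, Γ₂, n₂, hv, hu, rfl, rfl⟩ := h
    rw [Term.fv, Finset.mem_union]
    by_cases h0 : Γ₁ x = 0
    · obtain ⟨_, _, _, _, h1, h2⟩ := hu.exists_support (x := x) (by simpa [h0] using hx)
      exact .inr (ihu h1 h2)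
    · exact .inl (ihv hv h0)

/-! ### Environments of judgements -/

/-- The declarations `x : β` of a context. -/
noncomputable def pairs (Γ : Ctx V A) : Multiset (V × Ty A) := Γ.sum fun x a => a.map (Prod.mk x)

theorem pairs_add (Γ Δ : Ctx V A) : pairs (Γ + Δ) = pairs Γ + pairs Δ := by
  classical
  exact Finsupp.sum_add_index' (fun _ => Multiset.map_zero _) fun _ _ _ => Multiset.map_add _ _ _

theorem pairs_single (x : V) (a : Multiset (Ty A)) :
    pairs (Finsupp.single x a) = a.map (Prod.mk x) :=
  Finsupp.sum_single_index (Multiset.map_zero _)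

theorem ne_zero_of_mem_pairs {Γ : Ctx V A} {p : V × Ty A} (h : p ∈ pairs Γ) : Γ p.1 ≠ 0 := by
  rw [pairs, Finsupp.sum, Multiset.mem_sum] at h
  obtain ⟨x, _, hx⟩ := h
  obtain ⟨β, hβ, rfl⟩ := Multiset.mem_map.mp hx
  exact fun h0 => Multiset.notMem_zero β (h0 ▸ hβ)

/-- `Env ρ Γ' Γ n`: every declaration `x : β` of `Γ'` is given a judgement of `ρ x` of type `β`;
the sum of their contexts is `Γ`, and that of their sizes is `n`. -/
def Env.Sat (ρ : V → Sem V A) (Γ' Γ : Ctx V A) (n : ℕ) : Prop :=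
  Bag (fun p : V × Ty A => ρ p.1 p.2) (pairs Γ') Γ n

namespace Env.Sat

variable {ρ ρ' : V → Sem V A} {Γ' Δ' Γ : Ctx V A} {n : ℕ} {x : V}

theorem add_iff : Sat ρ (Γ' + Δ') Γ n ↔ ∃ Γ₁ n₁ Γ₂ n₂,
    Sat ρ Γ' Γ₁ n₁ ∧ Sat ρ Δ' Γ₂ n₂ ∧ Γ = Γ₁ + Γ₂ ∧ n = n₁ + n₂ := by
  rw [Sat, pairs_add]; exact Bag.add_iff

theorem single_iff {a : Multiset (Ty A)} :
    Sat ρ (Finsupp.single x a) Γ n ↔ Bag (ρ x) a Γ n := by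
  rw [Sat, pairs_single]; exact Bag.map_iff

theorem zero_iff : Sat ρ 0 Γ n ↔ Γ = 0 ∧ n = 0 := by
  rw [Sat, pairs, Finsupp.sum_zero_index]; exact Bag.zero_iff

theorem congr (H : ∀ x, Γ' x ≠ 0 → ρ x = ρ' x) : Sat ρ Γ' Γ n ↔ Sat ρ' Γ' Γ n := by
  refine Bag.congr fun p hp Γ n => ?_
  rw [H p.1 (ne_zero_of_mem_pairs hp)]

theorem exists_support (h : Sat ρ Γ' Γ n) (hx : Γ x ≠ 0) :
    ∃ y, Γ' y ≠ 0 ∧ ∃ β Δ m, ρ y β Δ m ∧ Δ x ≠ 0 := by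
  obtain ⟨p, hp, Δ, m, h1, h2⟩ := Bag.exists_support h hx
  exact ⟨p.1, ne_zero_of_mem_pairs hp, p.2, Δ, m, h1, h2⟩

end Env.Sat

/-- The judgements of a free variable, without the node that derives them. -/
def freeSem (x : V) : Sem V A := fun β Γ n => Γ = Finsupp.single x {β} ∧ n = 0

theorem bag_freeSem {x : V} {a : Multiset (Ty A)} {Γ : Ctx V A} {n : ℕ} :
    Bag (freeSem x) a Γ n ↔ Γ = Finsupp.single x a ∧ n = 0 := by
  induction a using Multiset.induction_on generalizing Γ n with
  | empty => rw [Bag.zero_iff, Finsupp.single_zero]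
  | cons β a ih =>
    simp only [Bag.cons_iff, ih, freeSem]
    constructor
    · rintro ⟨_, _, _, _, ⟨rfl, rfl⟩, ⟨rfl, rfl⟩, rfl, rfl⟩
      rw [← Finsupp.single_add, Multiset.singleton_add]
      exact ⟨rfl, rfl⟩
    · rintro ⟨rfl, rfl⟩
      refine ⟨_, _, _, _, ⟨rfl, rfl⟩, ⟨rfl, rfl⟩, ?_, rfl⟩
      rw [← Finsupp.single_add, Multiset.singleton_add]

theorem sat_freeSem {Γ' Γ : Ctx V A} {n : ℕ} :
    Env.Sat freeSem Γ' Γ n ↔ Γ = Γ' ∧ n = 0 := by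
  induction Γ' using Finsupp.induction generalizing Γ n with
  | zero => exact Env.Sat.zero_iff
  | single_add x a Γ' _ _ ih =>
    simp only [Env.Sat.add_iff, Env.Sat.single_iff, bag_freeSem, ih]
    constructor
    · rintro ⟨_, _, _, _, ⟨rfl, rfl⟩, ⟨rfl, rfl⟩, rfl, rfl⟩
      exact ⟨rfl, rfl⟩
    · rintro ⟨rfl, rfl⟩
      exact ⟨_, _, _, _, ⟨rfl, rfl⟩, ⟨rfl, rfl⟩, rfl, rfl⟩

/-- The judgements of `P` whose declarations are replaced by judgements of `ρ`. -/
def Comp (P : Sem V A) (ρ : V → Sem V A) : Sem V A := fun α Γ n =>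
  ∃ Γ' m k, P α Γ' m ∧ Env.Sat ρ Γ' Γ k ∧ n = m + k

theorem comp_freeSem {P : Sem V A} : Comp P freeSem = P := by
  ext α Γ n
  simp only [Comp, sat_freeSem]
  constructor
  · rintro ⟨_, _, _, h, ⟨rfl, rfl⟩, rfl⟩; exact h
  · intro h; exact ⟨_, _, _, h, ⟨rfl, rfl⟩, rfl⟩

theorem bag_comp {P : Sem V A} {ρ : V → Sem V A} {a : Multiset (Ty A)} {Γ : Ctx V A} {n : ℕ} :
    Bag (Comp P ρ) a Γ n ↔
      ∃ Γ' m k, Bag P a Γ' m ∧ Env.Sat ρ Γ' Γ k ∧ n = m + k := by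
  induction a using Multiset.induction_on generalizing Γ n with
  | empty =>
    simp only [Bag.zero_iff]
    constructor
    · rintro ⟨rfl, rfl⟩; exact ⟨_, _, _, ⟨rfl, rfl⟩, Env.Sat.zero_iff.mpr ⟨rfl, rfl⟩, rfl⟩
    · rintro ⟨_, _, _, ⟨rfl, rfl⟩, h, rfl⟩
      obtain ⟨rfl, rfl⟩ := Env.Sat.zero_iff.mp h
      exact ⟨rfl, rfl⟩
  | cons β a ih =>
    simp only [Bag.cons_iff, ih]
    constructor
    · rintro ⟨_, _, _, _, ⟨_, _, _, h1, h2, rfl⟩, ⟨_, _, _, h3, h4, rfl⟩, rfl, rfl⟩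
      exact ⟨_, _, _, ⟨_, _, _, _, h1, h3, rfl, rfl⟩,
        Env.Sat.add_iff.mpr ⟨_, _, _, _, h2, h4, rfl, rfl⟩, by omega⟩
    · rintro ⟨_, _, _, ⟨_, _, _, _, h1, h3, rfl, rfl⟩, h, rfl⟩
      obtain ⟨_, _, _, _, h2, h4, rfl, rfl⟩ := Env.Sat.add_iff.mp h
      exact ⟨_, _, _, _, ⟨_, _, _, h1, h2, rfl⟩, ⟨_, _, _, h3, h4, rfl⟩, rfl, by omega⟩

section Comp

variable {ρ : V → Sem V A} {α τ : Ty A} {Γ : Ctx V A} {n : ℕ} {x : V} {u t : Term V}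

/-- The axiom node is kept when a judgement of `ρ x` is plugged in: it pays for the lookup step. -/
theorem comp_var : Comp (sem (.var x)) ρ α Γ n ↔ ∃ k, n = k + 1 ∧ ρ x α Γ k := by
  constructor
  · rintro ⟨_, _, k, ⟨rfl, rfl⟩, h, rfl⟩
    exact ⟨k, by omega, Bag.singleton_iff.mp (Env.Sat.single_iff.mp h)⟩
  · rintro ⟨k, rfl, h⟩
    exact ⟨_, _, k, ⟨rfl, rfl⟩, Env.Sat.single_iff.mpr (Bag.singleton_iff.mpr h), by omega⟩

theorem comp_app : Comp (sem (.app t u)) ρ α Γ n ↔ ∃ a Γ₁ n₁ Γ₂ n₂,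
    Comp (sem t) ρ (Ty.arrow a α) Γ₁ n₁ ∧ Bag (Comp (sem u) ρ) a Γ₂ n₂ ∧
      Γ = Γ₁ + Γ₂ ∧ n = n₁ + n₂ + 1 := by
  constructor
  · rintro ⟨_, _, k, ⟨a, _, _, _, _, h1, h2, rfl, rfl⟩, h, rfl⟩
    obtain ⟨_, _, _, _, h3, h4, rfl, rfl⟩ := Env.Sat.add_iff.mp h
    exact ⟨a, _, _, _, _, ⟨_, _, _, h1, h3, rfl⟩, bag_comp.mpr ⟨_, _, _, h2, h4, rfl⟩, rfl,
      by omega⟩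
  · rintro ⟨a, _, _, _, _, ⟨_, _, _, h1, h3, rfl⟩, h, rfl, rfl⟩
    obtain ⟨_, _, _, h2, h4, rfl⟩ := bag_comp.mp h
    exact ⟨_, _, _, ⟨a, _, _, _, _, h1, h2, rfl, rfl⟩,
      Env.Sat.add_iff.mpr ⟨_, _, _, _, h3, h4, rfl, rfl⟩, by omega⟩

theorem comp_lam : Comp (sem (.lam x u)) ρ τ Γ n ↔ ∃ α Γ' m k,
    sem u α Γ' m ∧ Env.Sat ρ (Γ'.erase x) Γ k ∧ τ = Ty.arrow (Γ' x) α ∧ n = m + k + 1 := by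
  constructor
  · rintro ⟨_, _, k, ⟨α, Γ', m, h1, rfl, rfl, rfl⟩, h, rfl⟩
    exact ⟨α, Γ', m, k, h1, h, rfl, by omega⟩
  · rintro ⟨α, Γ', m, k, h1, h, rfl, rfl⟩
    exact ⟨_, _, k, ⟨α, Γ', m, h1, rfl, rfl, rfl⟩, h, by omega⟩

theorem sat_update [DecidableEq V] {Q : Sem V A} {Γ' : Ctx V A} :
    Env.Sat (Function.update ρ x Q) Γ' Γ n ↔ ∃ Γ₁ n₁ Γ₂ n₂,
      Env.Sat ρ (Γ'.erase x) Γ₁ n₁ ∧ Bag Q (Γ' x) Γ₂ n₂ ∧ Γ = Γ₁ + Γ₂ ∧ n = n₁ + n₂ := by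
  conv_lhs => rw [← Finsupp.erase_add_single x Γ']
  have e : ∀ Γ₁ n₁, Env.Sat (Function.update ρ x Q) (Γ'.erase x) Γ₁ n₁ ↔
      Env.Sat ρ (Γ'.erase x) Γ₁ n₁ := fun Γ₁ n₁ => Env.Sat.congr fun y hy => by
    refine Function.update_of_ne ?_ _ _
    rintro rfl
    simp at hy
  simp only [Env.Sat.add_iff, Env.Sat.single_iff, Function.update_self, e]

theorem comp_update [DecidableEq V] {P Q : Sem V A} :
    Comp P (Function.update ρ x Q) α Γ n ↔ ∃ Γ' m Γ₁ n₁ Γ₂ n₂, P α Γ' m ∧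
      Env.Sat ρ (Γ'.erase x) Γ₁ n₁ ∧ Bag Q (Γ' x) Γ₂ n₂ ∧ Γ = Γ₁ + Γ₂ ∧
      n = m + n₁ + n₂ := by
  simp only [Comp, sat_update]
  constructor
  · rintro ⟨_, _, _, h, ⟨_, _, _, _, h1, h2, rfl, rfl⟩, rfl⟩
    exact ⟨_, _, _, _, _, _, h, h1, h2, rfl, by omega⟩
  · rintro ⟨_, _, _, _, _, _, h, h1, h2, rfl, rfl⟩
    exact ⟨_, _, _, h, ⟨_, _, _, _, h1, h2, rfl, rfl⟩, by omega⟩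

end Comp

/-! ### Substitution, α-equivalence and β-reduction -/

/-- The judgements of `P`, with sizes lowered by one. -/
def Sem.shift (P : Sem V A) : Sem V A := fun β Γ n => P β Γ (n + 1)

theorem shift_sem_var (x : V) : (sem (.var x) : Sem V A).shift = freeSem x := by
  ext β Γ n
  simp [Sem.shift, sem, freeSem]

/-- A family of judgements of `t` in which each size is lowered by one. -/
theorem bag_sem_iff {t : Term V} {a : Multiset (Ty A)} {Γ : Ctx V A} {n : ℕ} :
    Bag (sem t) a Γ n ↔ ∃ m, n = m + a.card ∧ Bag (sem t).shift a Γ m :=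
  Bag.pred fun _ _ _ => sem_pos

theorem Term.fresh_notMem [Infinite V] (s : Finset V) : Term.fresh s ∉ s :=
  (Infinite.exists_notMem_finset s).choose_spec

theorem sem_lam {x : V} {u : Term V} {τ : Ty A} {Γ : Ctx V A} {n : ℕ} :
    sem (.lam x u) τ Γ n ↔ ∃ α Γ' m, sem u α Γ' m ∧ τ = Ty.arrow (Γ' x) α ∧
      Γ = Γ'.erase x ∧ n = m + 1 := Iff.rfl

theorem erase_eq_self {Γ : Ctx V A} {x : V} (h : Γ x = 0) : Γ.erase x = Γ :=
  Finsupp.erase_of_notMem_support (by simpa using h)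

section Subst

variable [DecidableEq V] [Infinite V]

/-- Substituting replaces each axiom of a free variable by a derivation for the substituted term.
The axiom node disappears, which is why the plugged judgements are counted with sizes lowered by
one. -/
theorem sem_substAll (t : Term V) (σ : V → Term V) :
    (sem (t.substAll σ) : Sem V A) = Comp (sem t) fun x => (sem (σ x)).shift := by
  induction t generalizing σ with
  | var x =>
    ext α Γ n
    rw [comp_var, Term.substAll]
    constructor
    · intro h
      obtain ⟨k, rfl⟩ := Nat.exists_eq_add_of_lt (sem_pos h)
      rw [zero_add] at h
      exact ⟨k, by omega, h⟩
    · rintro ⟨k, rfl, h⟩; exact h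
  | app v u ihv ihu =>
    ext α Γ n
    rw [comp_app, Term.substAll, ← ihv, ← ihu]
    rfl
  | lam x u ih =>
    ext τ Γ n
    rw [comp_lam, Term.substAll]
    set y := Term.fresh ((Term.lam x u).fv.biUnion fun z => (σ z).fv) with hy
    have hfresh : ∀ z ∈ (Term.lam x u).fv, y ∉ (σ z).fv := fun z hz hyz =>
      Term.fresh_notMem _ (Finset.mem_biUnion.mpr ⟨z, hz, hyz⟩)
    have e : (fun z => (sem (Function.update σ x (.var y) z) : Sem V A).shift) =
        Function.update (fun z => (sem (σ z)).shift) x (freeSem y) := by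
      ext1 z
      by_cases hz : z = x
      · subst hz; simp [shift_sem_var]
      · simp [hz]
    -- Judgements declare free variables only, so the fresh `y` is not declared by the substituted
    -- terms; the multiset discharged at `y` is then exactly `Γ' x`.
    have h0 : ∀ {α Γ' m Δ k}, (sem u : Sem V A) α Γ' m →
        Env.Sat (fun z => (sem (σ z)).shift) (Γ'.erase x) Δ k → Δ y = 0 := by
      intro α Γ' m Δ k hu hs
      by_contra hne
      obtain ⟨z, hz, β, Θ, j, h1, h2⟩ := hs.exists_support hne
      have hzx : z ≠ x := by rintro rfl; simp at hz
      rw [Finsupp.erase_ne hzx] at hz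
      exact hfresh z (Finset.mem_erase.mpr ⟨hzx, sem_support hu hz⟩) (sem_support h1 h2)
    simp only [sem, ih, e, comp_update, bag_freeSem]
    constructor
    · rintro ⟨α, _, _, ⟨Γ', m, Δ, k, _, _, hu, hs, ⟨rfl, rfl⟩, rfl, rfl⟩, rfl, rfl, rfl⟩
      have hΔ := h0 hu hs
      refine ⟨α, Γ', m, k, hu, ?_, by simp [hΔ], by omega⟩
      rwa [Finsupp.erase_add, Finsupp.erase_single, add_zero, erase_eq_self hΔ]
    · rintro ⟨α, Γ', m, k, hu, hs, rfl, rfl⟩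
      have hΔ := h0 hu hs
      refine ⟨α, Γ + Finsupp.single y (Γ' x), m + k, ⟨Γ', m, Γ, k, _, _, hu, hs, ⟨rfl, rfl⟩, rfl,
        by omega⟩, by simp [hΔ], ?_, rfl⟩
      rw [Finsupp.erase_add, Finsupp.erase_single, add_zero, erase_eq_self hΔ]

theorem sem_subst {u v : Term V} {x : V} {α : Ty A} {Γ : Ctx V A} {n : ℕ} :
    sem (u.subst x v) α Γ n ↔ ∃ Γ' m Γ₂ n₂, sem u α Γ' m ∧
      Bag (sem v).shift (Γ' x) Γ₂ n₂ ∧ Γ = Γ'.erase x + Γ₂ ∧ n = m + n₂ := by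
  have e : (fun z => (sem (Function.update Term.var x v z) : Sem V A).shift) =
      Function.update freeSem x (sem v).shift := by
    ext1 z
    by_cases hz : z = x
    · subst hz; simp
    · simp [hz, shift_sem_var]
  rw [Term.subst, sem_substAll, e, comp_update]
  simp only [sat_freeSem]
  constructor
  · rintro ⟨Γ', m, _, _, Γ₂, n₂, hu, ⟨rfl, rfl⟩, hv, rfl, rfl⟩
    exact ⟨Γ', m, Γ₂, n₂, hu, hv, rfl, rfl⟩
  · rintro ⟨Γ', m, Γ₂, n₂, hu, hv, rfl, rfl⟩
    exact ⟨Γ', m, _, _, Γ₂, n₂, hu, ⟨rfl, rfl⟩, hv, rfl, rfl⟩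

theorem sem_eq_of_alphaEq {t t' : Term V} (h : Term.AlphaEq t t') :
    (sem t : Sem V A) = sem t' := by
  induction h with
  | rename x y u hy =>
    ext τ Γ n
    have key : ∀ {α : Ty A} {Γ' : Ctx V A} {m}, sem u α Γ' m → Γ'.erase x y = 0 := by
      intro α Γ' m hu
      by_contra hne
      have hxy : y ≠ x := by rintro rfl; simp at hne
      rw [Finsupp.erase_ne hxy] at hne
      exact hy (Finset.mem_erase.mpr ⟨hxy, sem_support hu hne⟩)
    simp only [sem_lam, sem_subst, shift_sem_var, bag_freeSem]
    constructor
    · rintro ⟨α, Γ', m, hu, rfl, rfl, rfl⟩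
      have h0 := key hu
      refine ⟨α, _, m, ⟨Γ', m, _, _, hu, ⟨rfl, rfl⟩, rfl, rfl⟩, by simp [h0], ?_, rfl⟩
      rw [Finsupp.erase_add, Finsupp.erase_single, add_zero, erase_eq_self h0]
    · rintro ⟨α, _, _, ⟨Γ', m, _, _, hu, ⟨rfl, rfl⟩, rfl, rfl⟩, rfl, rfl, rfl⟩
      have h0 := key hu
      refine ⟨α, Γ', _, hu, by simp [h0], ?_, rfl⟩
      rw [Finsupp.erase_add, Finsupp.erase_single, add_zero, erase_eq_self h0]
  | refl => rfl
  | symm _ ih => exact ih.symm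
  | trans _ _ ih1 ih2 => exact ih1.trans ih2
  | app _ _ ih1 ih2 => simp only [sem, ih1, ih2]
  | lam x _ ih => simp only [sem, ih]

/-- A head redex is typed like its contractum, and by larger derivations. -/
theorem exists_sem_subst {u v : Term V} {x : V} {α : Ty A} {Γ : Ctx V A} {n : ℕ}
    (h : sem (.app (.lam x u) v) α Γ n) : ∃ m < n, sem (u.subst x v) α Γ m := by
  obtain ⟨a, _, _, Γ₂, _, ⟨α', Γ', m, hu, h, rfl, rfl⟩, hv, rfl, rfl⟩ := h
  obtain ⟨rfl, rfl⟩ := Ty.arrow_injective h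
  obtain ⟨k, rfl, hv'⟩ := bag_sem_iff.mp hv
  exact ⟨m + k, by omega, sem_subst.mpr ⟨Γ', m, Γ₂, k, hu, hv', rfl, rfl⟩⟩

/-- `Γ ⊢ t : α` is derivable. -/
def Typable (t : Term V) (α : Ty A) (Γ : Ctx V A) : Prop := ∃ n, sem t α Γ n

/-- Sizes are dropped because an argument is typed once per element of a multiset, possibly never,
so a reduction inside it changes the size by no fixed amount. Judgements themselves are invariant,
the redex case being `sem_subst` read in both directions. -/
theorem typable_iff_of_beta {t t' : Term V} (h : Term.Beta t t') {α : Ty A} {Γ : Ctx V A} :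
    Typable t α Γ ↔ Typable t' α Γ := by
  induction h generalizing α Γ with
  | redex x u v =>
    constructor
    · rintro ⟨n, h⟩
      obtain ⟨m, _, h⟩ := exists_sem_subst h
      exact ⟨m, h⟩
    · rintro ⟨n, h⟩
      obtain ⟨Γ', m, Γ₂, k, hu, hv, rfl, rfl⟩ := sem_subst.mp h
      exact ⟨_, _, _, _, _, _, ⟨α, Γ', m, hu, rfl, rfl, rfl⟩, bag_sem_iff.mpr ⟨k, rfl, hv⟩, rfl,
        rfl⟩
  | appLeft u _ ih =>
    constructor
    · rintro ⟨_, a, _, _, _, _, hv, hu, rfl, rfl⟩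
      obtain ⟨_, hv⟩ := ih.mp ⟨_, hv⟩
      exact ⟨_, a, _, _, _, _, hv, hu, rfl, rfl⟩
    · rintro ⟨_, a, _, _, _, _, hv, hu, rfl, rfl⟩
      obtain ⟨_, hv⟩ := ih.mpr ⟨_, hv⟩
      exact ⟨_, a, _, _, _, _, hv, hu, rfl, rfl⟩
  | appRight v _ ih =>
    constructor
    · rintro ⟨_, a, _, _, _, _, hv, hu, rfl, rfl⟩
      obtain ⟨_, hu⟩ := hu.exists_mono fun i Γ n h => ih.mp ⟨n, h⟩
      exact ⟨_, a, _, _, _, _, hv, hu, rfl, rfl⟩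
    · rintro ⟨_, a, _, _, _, _, hv, hu, rfl, rfl⟩
      obtain ⟨_, hu⟩ := hu.exists_mono fun i Γ n h => ih.mpr ⟨n, h⟩
      exact ⟨_, a, _, _, _, _, hv, hu, rfl, rfl⟩
  | lam x _ ih =>
    constructor
    · rintro ⟨_, α, Γ', _, hu, rfl, rfl, rfl⟩
      obtain ⟨_, hu⟩ := ih.mp ⟨_, hu⟩
      exact ⟨_, α, Γ', _, hu, rfl, rfl, rfl⟩
    · rintro ⟨_, α, Γ', _, hu, rfl, rfl, rfl⟩
      obtain ⟨_, hu⟩ := ih.mpr ⟨_, hu⟩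
      exact ⟨_, α, Γ', _, hu, rfl, rfl, rfl⟩

theorem typable_iff_of_normalForm {n t : Term V} (h : Term.IsNormalFormOf n t) {α : Ty A}
    {Γ : Ctx V A} : Typable t α Γ ↔ Typable n α Γ := by
  replace h := h.1
  induction h with
  | refl => rfl
  | tail _ hb ih => exact ih.trans (typable_iff_of_beta hb)

end Subst

/-! ### Arguments of an application -/

/-- `Args Ps as Γ n`: for the sets of judgements `P₁, …, Pₖ` and the multisets `a₁, …, aₖ` there
are families of judgements of `Pᵢ` indexed by `aᵢ`, with sums `Γ` and `n`. -/
inductive Args : List (Sem V A) → List (Multiset (Ty A)) → Ctx V A → ℕ → Prop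
  | nil : Args [] [] 0 0
  | cons {P : Sem V A} {Ps : List (Sem V A)} {a : Multiset (Ty A)}
      {as : List (Multiset (Ty A))} {Γ Δ : Ctx V A} {n m : ℕ} :
      Bag P a Γ n → Args Ps as Δ m → Args (P :: Ps) (a :: as) (Γ + Δ) (n + m)

theorem args_cons_iff {P : Sem V A} {Ps : List (Sem V A)} {as : List (Multiset (Ty A))}
    {Γ : Ctx V A} {n : ℕ} : Args (P :: Ps) as Γ n ↔ ∃ a bs Γ₁ n₁ Γ₂ n₂, as = a :: bs ∧
      Bag P a Γ₁ n₁ ∧ Args Ps bs Γ₂ n₂ ∧ Γ = Γ₁ + Γ₂ ∧ n = n₁ + n₂ := by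
  constructor
  · intro h
    cases h with
    | cons h1 h2 => exact ⟨_, _, _, _, _, _, rfl, h1, h2, rfl, rfl⟩
  · rintro ⟨_, _, _, _, _, _, rfl, h1, h2, rfl, rfl⟩
    exact .cons h1 h2

theorem args_nil_iff {as : List (Multiset (Ty A))} {Γ : Ctx V A} {n : ℕ} :
    Args [] as Γ n ↔ as = [] ∧ Γ = 0 ∧ n = 0 := by
  constructor
  · intro h; cases h; exact ⟨rfl, rfl, rfl⟩
  · rintro ⟨rfl, rfl, rfl⟩; exact .nil

/-- `P` applied to the arguments `Ps`; the applications are not counted. -/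
def Apply (P : Sem V A) (Ps : List (Sem V A)) : Sem V A := fun α Γ n =>
  ∃ as Γ₁ n₁ Γ₂ n₂, P (Ty.arrows as α) Γ₁ n₁ ∧ Args Ps as Γ₂ n₂ ∧ Γ = Γ₁ + Γ₂ ∧ n = n₁ + n₂

theorem apply_nil {P : Sem V A} : Apply P [] = P := by
  ext α Γ n
  simp only [Apply, args_nil_iff]
  constructor
  · rintro ⟨_, _, _, _, _, h, ⟨rfl, rfl, rfl⟩, rfl, rfl⟩
    simpa [Ty.arrows] using h
  · intro h
    exact ⟨[], _, _, _, _, h, ⟨rfl, rfl, rfl⟩, by simp, by simp⟩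

theorem apply_cons {P Q : Sem V A} {Ps : List (Sem V A)} : Apply P (Q :: Ps) =
    Apply (fun α Γ n => ∃ a Γ₁ n₁ Γ₂ n₂, P (Ty.arrow a α) Γ₁ n₁ ∧ Bag Q a Γ₂ n₂ ∧ Γ = Γ₁ + Γ₂ ∧
      n = n₁ + n₂) Ps := by
  ext α Γ n
  simp only [Apply, args_cons_iff]
  constructor
  · rintro ⟨_, _, _, _, _, h1, ⟨a, as, _, _, _, _, rfl, h2, h3, rfl, rfl⟩, rfl, rfl⟩
    exact ⟨as, _, _, _, _, ⟨a, _, _, _, _, h1, h2, rfl, rfl⟩, h3, by abel, by omega⟩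
  · rintro ⟨as, _, _, _, _, ⟨a, _, _, _, _, h1, h2, rfl, rfl⟩, h3, rfl, rfl⟩
    exact ⟨a :: as, _, _, _, _, h1, ⟨a, as, _, _, _, _, rfl, h2, h3, rfl, rfl⟩, by abel, by omega⟩

/-- Carries the loss of one node at the head over to the whole state; all three clauses of
`stepState` are handled by it. -/
theorem apply_congr_succ {P P' : Sem V A} {Ps : List (Sem V A)}
    (h : ∀ α Γ n, P α Γ n ↔ ∃ k, n = k + 1 ∧ P' α Γ k) {α : Ty A} {Γ : Ctx V A} {n : ℕ} :
    Apply P Ps α Γ n ↔ ∃ k, n = k + 1 ∧ Apply P' Ps α Γ k := by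
  simp only [Apply, h]
  constructor
  · rintro ⟨as, _, _, _, _, ⟨k, rfl, h1⟩, h2, rfl, rfl⟩
    exact ⟨_, by omega, as, _, _, _, _, h1, h2, rfl, rfl⟩
  · rintro ⟨_, rfl, as, _, k, _, _, h1, h2, rfl, rfl⟩
    exact ⟨as, _, _, _, _, ⟨k, rfl, h1⟩, h2, rfl, by omega⟩

theorem sem_appList {t : Term V} {us : List (Term V)} {α : Ty A} {Γ : Ctx V A} {n : ℕ} :
    sem (t.appList us) α Γ n ↔ ∃ m, n = m + us.length ∧ Apply (sem t) (us.map sem) α Γ m := by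
  induction us generalizing t n with
  | nil => simp [Term.appList, apply_nil]
  | cons u us ih =>
    have e : t.appList (u :: us) = (t.app u).appList us := rfl
    have key : ∀ α (Γ : Ctx V A) n, sem (t.app u) α Γ n ↔ ∃ k, n = k + 1 ∧ ∃ a Γ₁ n₁ Γ₂ n₂,
        sem t (Ty.arrow a α) Γ₁ n₁ ∧ Bag (sem u) a Γ₂ n₂ ∧ Γ = Γ₁ + Γ₂ ∧ k = n₁ + n₂ := by
      intro α Γ n
      constructor
      · rintro ⟨a, _, _, _, _, h1, h2, rfl, rfl⟩
        exact ⟨_, rfl, a, _, _, _, _, h1, h2, rfl, rfl⟩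
      · rintro ⟨_, rfl, a, _, _, _, _, h1, h2, rfl, rfl⟩
        exact ⟨a, _, _, _, _, h1, h2, rfl, rfl⟩
    simp only [e, ih, apply_congr_succ key, List.map_cons, apply_cons, List.length_cons]
    constructor
    · rintro ⟨_, rfl, k, rfl, h⟩
      exact ⟨k, by omega, h⟩
    · rintro ⟨k, rfl, h⟩
      exact ⟨_, by omega, k, rfl, h⟩

/-! ### Weights of types -/

mutual

/-- The weight of a type at a positive (`true`) or negative (`false`) occurrence. -/
def PreTy.weight : PreTy A → Bool → ℕ
  | .atom _, b => if b then 0 else 1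
  | .arrow a α, b => 1 + PreTy.weights a (!b) + PreTy.weight α b

/-- The sum of the weights of the types of a sequence. -/
def PreTy.weights : List (PreTy A) → Bool → ℕ
  | [], _ => 0
  | α :: a, b => PreTy.weight α b + PreTy.weights a b

end

theorem PreTy.weight_eq {p q : PreTy A} (h : PreTy.Rel p q) (b : Bool) :
    p.weight b = q.weight b := by
  induction h generalizing b with
  | refl => rfl
  | symm _ ih => exact (ih b).symm
  | trans _ _ ih1 ih2 => exact (ih1 b).trans (ih2 b)
  | right a _ ih => simp only [PreTy.weight, ih]
  | cons _ _ ih1 ih2 =>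
    have := ih2 b
    simp only [PreTy.weight, PreTy.weights, ih1] at this ⊢
    omega
  | swap => simp only [PreTy.weight, PreTy.weights]; omega

namespace Ty

/-- The weight of a type at a positive (`true`) or negative (`false`) occurrence. -/
def weight (b : Bool) : Ty A → ℕ :=
  Quotient.lift (s := PreTy.setoid A) (fun p => p.weight b) fun _ _ h => PreTy.weight_eq h b

/-- The sum of the weights of the types of a multiset. -/
def bagWeight (b : Bool) (a : Multiset (Ty A)) : ℕ := (a.map (weight b)).sum

theorem weight_atom (b : Bool) (γ : A) : weight b (atom γ) = if b then 0 else 1 := by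
  change PreTy.weight _ _ = _
  rw [PreTy.weight]

theorem weights_eq_sum (b : Bool) (l : List (PreTy A)) :
    PreTy.weights l b = ((l.map mk).map (weight b)).sum := by
  induction l with
  | nil => rw [PreTy.weights]; rfl
  | cons p l ih => rw [PreTy.weights, ih]; rfl

theorem weight_arrow (b : Bool) (a : Multiset (Ty A)) (α : Ty A) :
    weight b (arrow a α) = 1 + bagWeight (!b) a + weight b α := by
  have h1 : weight b (arrow a α) =
      1 + PreTy.weights (a.toList.map out) (!b) + weight b (mk (out α)) := by
    change PreTy.weight _ _ = _
    rw [PreTy.weight]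
    rfl
  have e : (a.toList.map out).map mk = a.toList := by
    rw [List.map_map, show (mk ∘ out : Ty A → Ty A) = id from funext mk_out, List.map_id]
  rw [h1, mk_out, weights_eq_sum, e, bagWeight]
  conv_rhs => rw [← Multiset.coe_toList a]
  rw [Multiset.map_coe, Multiset.sum_coe]

/-- This positive contribution accounts for the node of the head variable, whatever the result type
of its application. -/
theorem weight_false_pos (α : Ty A) : 0 < weight false α := by
  induction α using Ty.induction with
  | hatom γ => simp [weight_atom]
  | harrow a α => rw [weight_arrow]; omega

theorem bagWeight_zero (b : Bool) : bagWeight b (0 : Multiset (Ty A)) = 0 := rfl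

theorem bagWeight_cons (b : Bool) (α : Ty A) (a : Multiset (Ty A)) :
    bagWeight b (α ::ₘ a) = weight b α + bagWeight b a := by simp [bagWeight]

theorem bagWeight_singleton (b : Bool) (α : Ty A) : bagWeight b {α} = weight b α := by
  simp [bagWeight]

theorem bagWeight_add (b : Bool) (a a' : Multiset (Ty A)) :
    bagWeight b (a + a') = bagWeight b a + bagWeight b a' := by simp [bagWeight]

theorem weight_arrows (b : Bool) (as : List (Multiset (Ty A))) (α : Ty A) :
    weight b (arrows as α) = as.length + (as.map (bagWeight (!b))).sum + weight b α := by
  induction as with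
  | nil => simp [arrows]
  | cons a as ih =>
    have e : arrows (a :: as) α = arrow a (arrows as α) := rfl
    rw [e, weight_arrow, ih]
    simp only [List.length_cons, List.map_cons, List.sum_cons]
    omega

end Ty

/-- The weight of a context. -/
noncomputable def ctxWeight (Γ : Ctx V A) : ℕ := Γ.sum fun _ a => Ty.bagWeight false a

theorem ctxWeight_zero : ctxWeight (0 : Ctx V A) = 0 := Finsupp.sum_zero_index

theorem ctxWeight_add (Γ Δ : Ctx V A) : ctxWeight (Γ + Δ) = ctxWeight Γ + ctxWeight Δ := by
  classical
  exact Finsupp.sum_add_index' (fun _ => rfl) fun _ _ _ => Ty.bagWeight_add _ _ _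

theorem ctxWeight_single (x : V) (a : Multiset (Ty A)) :
    ctxWeight (Finsupp.single x a) = Ty.bagWeight false a :=
  Finsupp.sum_single_index rfl

theorem ctxWeight_erase_add (Γ : Ctx V A) (x : V) :
    ctxWeight (Γ.erase x) + Ty.bagWeight false (Γ x) = ctxWeight Γ := by
  rw [← ctxWeight_single x, ← ctxWeight_add, Finsupp.erase_add_single]

/-! ### The sets of types without empty multisets at positive or negative occurrences -/

theorem dex_arrow_iff {a : Multiset (Ty A)} {α : Ty A} :
    Dex (Ty.arrow a α) ↔ (∀ β ∈ a, DexBar β) ∧ Dex α := by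
  refine ⟨fun h => ?_, fun h => .arrow a α h.1 h.2⟩
  generalize hτ : Ty.arrow a α = τ at h
  cases h with
  | atom γ => exact absurd hτ.symm (Ty.atom_ne_arrow _ _ _)
  | arrow b β h1 h2 =>
    obtain ⟨rfl, rfl⟩ := Ty.arrow_injective hτ
    exact ⟨h1, h2⟩

theorem dexBar_arrow_iff {a : Multiset (Ty A)} {α : Ty A} :
    DexBar (Ty.arrow a α) ↔ (a ≠ 0 ∧ ∀ β ∈ a, Dex β) ∧ DexBar α := by
  refine ⟨fun h => ?_, fun h => .arrow a α h.1.1 h.1.2 h.2⟩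
  generalize hτ : Ty.arrow a α = τ at h
  cases h with
  | atom γ => exact absurd hτ.symm (Ty.atom_ne_arrow _ _ _)
  | arrow b β h0 h1 h2 =>
    obtain ⟨rfl, rfl⟩ := Ty.arrow_injective hτ
    exact ⟨⟨h0, h1⟩, h2⟩

theorem dexBar_arrows_iff {as : List (Multiset (Ty A))} {α : Ty A} :
    DexBar (Ty.arrows as α) ↔ (∀ a ∈ as, a ≠ 0 ∧ ∀ β ∈ a, Dex β) ∧ DexBar α := by
  induction as with
  | nil => simp [Ty.arrows]
  | cons a as ih =>
    have e : Ty.arrows (a :: as) α = Ty.arrow a (Ty.arrows as α) := rfl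
    simp only [e, dexBar_arrow_iff, ih, List.forall_mem_cons, and_assoc]

theorem phiEx_zero : PhiEx (0 : Ctx V A) := fun _ _ h => absurd h (Multiset.notMem_zero _)

theorem phiEx_add_iff {Γ Δ : Ctx V A} : PhiEx (Γ + Δ) ↔ PhiEx Γ ∧ PhiEx Δ := by
  simp only [PhiEx, Finsupp.add_apply, Multiset.mem_add, or_imp, forall_and]

theorem phiEx_single_iff {x : V} {a : Multiset (Ty A)} :
    PhiEx (Finsupp.single x a) ↔ ∀ β ∈ a, DexBar β := by
  constructor
  · intro h β hβ
    exact h x β (by simpa using hβ)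
  · intro h y β hβ
    by_cases hxy : y = x
    · subst hxy; exact h β (by simpa using hβ)
    · rw [Finsupp.single_eq_of_ne hxy] at hβ
      exact absurd hβ (Multiset.notMem_zero _)

theorem phiEx_erase_iff {Γ : Ctx V A} {x : V} :
    PhiEx Γ ↔ PhiEx (Γ.erase x) ∧ ∀ β ∈ Γ x, DexBar β := by
  conv_lhs => rw [← Finsupp.erase_add_single x Γ, phiEx_add_iff, phiEx_single_iff]

/-! ### Bounds for the judgements without empty multisets at positive occurrences -/

/-- Every judgement of `P` in `Φ^ex × D^ex` has at least the size `m` and the weight `N > 0`, and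
has size `m` if it has weight `N`. -/
def Bounded (P : Sem V A) (m N : ℕ) : Prop :=
  0 < N ∧ ∀ α Γ n, P α Γ n → PhiEx Γ → Dex α →
    m ≤ n ∧ N ≤ ctxWeight Γ + α.weight true ∧ (ctxWeight Γ + α.weight true ≤ N → n ≤ m)

/-- Some judgement of `P` in `Φ^ex × D^ex` has size `m` and weight `N`. -/
def Attained (P : Sem V A) (m N : ℕ) : Prop :=
  ∃ α Γ, P α Γ m ∧ PhiEx Γ ∧ Dex α ∧ ctxWeight Γ + α.weight true = N

/-- A family with two members weighs at least `2 * N`, which exceeds `N` because `N` is positive. So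
weight at most `N` leaves a single member, of least weight and hence of size `m`. -/
theorem Bounded.bag {P : Sem V A} {m N : ℕ} (hP : Bounded P m N) {a : Multiset (Ty A)}
    {Γ : Ctx V A} {n : ℕ} (h : Bag P a Γ n) (hΓ : PhiEx Γ) (ha : ∀ β ∈ a, Dex β) (h0 : a ≠ 0) :
    m ≤ n ∧ N ≤ ctxWeight Γ + Ty.bagWeight true a ∧
      (ctxWeight Γ + Ty.bagWeight true a ≤ N → n ≤ m) := by
  induction h with
  | zero => exact absurd rfl h0
  | @cons β a Γ Δ n k h1 h2 ih =>
    obtain ⟨hΓ, hΔ⟩ := phiEx_add_iff.mp hΓ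
    obtain ⟨b1, b2, b3⟩ := hP.2 _ _ _ h1 hΓ (ha β (Multiset.mem_cons_self _ _))
    rw [ctxWeight_add, Ty.bagWeight_cons]
    by_cases h0' : a = 0
    · subst h0'
      obtain ⟨rfl, rfl⟩ := Bag.zero_iff.mp h2
      rw [ctxWeight_zero, Ty.bagWeight_zero]
      exact ⟨by omega, by omega, fun h => b3 (by omega)⟩
    · obtain ⟨c1, c2, c3⟩ := ih hΔ (fun β hβ => ha β (Multiset.mem_cons_of_mem hβ)) h0'
      have := hP.1
      exact ⟨by omega, by omega, fun h => absurd h (by omega)⟩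

theorem Args.length_eq {Ps : List (Sem V A)} {as : List (Multiset (Ty A))} {Γ : Ctx V A} {n : ℕ}
    (h : Args Ps as Γ n) : as.length = Ps.length := by
  induction h with
  | nil => rfl
  | cons _ _ ih => simp [ih]

/-- Each argument has at least its own least weight, so a total that does not exceed the sum of
these forces every one of them to be attained. -/
theorem Bounded.args {Ps : List (Sem V A)} {l : List (ℕ × ℕ)}
    (hP : List.Forall₂ (fun P p => Bounded P p.1 p.2) Ps l) {as : List (Multiset (Ty A))}
    {Γ : Ctx V A} {n : ℕ} (h : Args Ps as Γ n) (hΓ : PhiEx Γ)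
    (has : ∀ a ∈ as, a ≠ 0 ∧ ∀ β ∈ a, Dex β) :
    (l.map Prod.fst).sum ≤ n ∧
      (l.map Prod.snd).sum ≤ ctxWeight Γ + (as.map (Ty.bagWeight true)).sum ∧
      (ctxWeight Γ + (as.map (Ty.bagWeight true)).sum ≤ (l.map Prod.snd).sum →
        n ≤ (l.map Prod.fst).sum) := by
  induction hP generalizing as Γ n with
  | nil =>
    obtain ⟨rfl, rfl, rfl⟩ := args_nil_iff.mp h
    simp
  | cons hP _ ih =>
    obtain ⟨a, as, _, _, _, _, rfl, h1, h2, rfl, rfl⟩ := args_cons_iff.mp h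
    obtain ⟨hΓ, hΔ⟩ := phiEx_add_iff.mp hΓ
    rw [List.forall_mem_cons] at has
    obtain ⟨b1, b2, b3⟩ := hP.bag h1 hΓ has.1.2 has.1.1
    obtain ⟨c1, c2, c3⟩ := ih h2 hΔ has.2
    simp only [ctxWeight_add, List.map_cons, List.sum_cons]
    refine ⟨by omega, by omega, fun h => ?_⟩
    have := b3 (by omega)
    have := c3 (by omega)
    omega

/-- The type of the head variable is in `DexBar`, so its argument multisets are non-empty with
members in `Dex`, as `Bounded.args` requires. In the weight, `Ps.length` counts the arrows of that
type and the last `1` comes from `Ty.weight_false_pos`. -/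
theorem Bounded.apply_var {Ps : List (Sem V A)} {l : List (ℕ × ℕ)} (x : V)
    (hP : List.Forall₂ (fun P p => Bounded P p.1 p.2) Ps l) :
    Bounded (Apply (sem (.var x)) Ps) ((l.map Prod.fst).sum + 1)
      ((l.map Prod.snd).sum + Ps.length + 1) := by
  refine ⟨by omega, ?_⟩
  rintro α _ _ ⟨as, _, _, Γ, n, ⟨rfl, rfl⟩, h, rfl, rfl⟩ hΓ hα
  obtain ⟨hx, hΓ⟩ := phiEx_add_iff.mp hΓ
  obtain ⟨has, -⟩ := dexBar_arrows_iff.mp (phiEx_single_iff.mp hx _ (Multiset.mem_singleton_self _))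
  obtain ⟨b1, b2, b3⟩ := Bounded.args hP h hΓ has
  rw [ctxWeight_add, ctxWeight_single, Ty.bagWeight_singleton, Ty.weight_arrows, h.length_eq]
  have := Ty.weight_false_pos α
  simp only [Bool.not_false]
  refine ⟨by omega, by omega, fun h => ?_⟩
  have := b3 (by omega)
  omega

theorem Attained.args {Ps : List (Sem V A)} {l : List (ℕ × ℕ)}
    (hP : List.Forall₂ (fun P p => Attained P p.1 p.2) Ps l) :
    ∃ as Γ, Args Ps as Γ (l.map Prod.fst).sum ∧ PhiEx Γ ∧ (∀ a ∈ as, a ≠ 0 ∧ ∀ β ∈ a, Dex β) ∧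
      ctxWeight Γ + (as.map (Ty.bagWeight true)).sum = (l.map Prod.snd).sum := by
  induction hP with
  | nil => exact ⟨[], 0, .nil, phiEx_zero, by simp, by simp [ctxWeight_zero]⟩
  | cons hP _ ih =>
    obtain ⟨as, Γ, h, hΓ, has, hw⟩ := ih
    obtain ⟨α, Δ, h', hΔ, hα, hw'⟩ := hP
    refine ⟨{α} :: as, Δ + Γ, .cons (Bag.singleton_iff.mpr h') h, phiEx_add_iff.mpr ⟨hΔ, hΓ⟩,
      ?_, ?_⟩
    · rw [List.forall_mem_cons]
      exact ⟨⟨Multiset.singleton_ne_zero α, by simpa using hα⟩, has⟩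
    · simp only [ctxWeight_add, List.map_cons, List.sum_cons, Ty.bagWeight_singleton]
      omega

/-- An atomic result type is optimal: it weighs one in the type of the head variable and nothing on
the right. Each argument is typed exactly once. -/
theorem Attained.apply_var [Nonempty A] {Ps : List (Sem V A)} {l : List (ℕ × ℕ)} (x : V)
    (hP : List.Forall₂ (fun P p => Attained P p.1 p.2) Ps l) :
    Attained (Apply (sem (.var x)) Ps) ((l.map Prod.fst).sum + 1)
      ((l.map Prod.snd).sum + Ps.length + 1) := by
  obtain ⟨as, Γ, h, hΓ, has, hw⟩ := Attained.args hP
  let γ : A := Classical.arbitrary A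
  refine ⟨Ty.atom γ, Finsupp.single x {Ty.arrows as (Ty.atom γ)} + Γ,
    ⟨as, _, 1, Γ, _, ⟨rfl, rfl⟩, h, rfl, by omega⟩, phiEx_add_iff.mpr ⟨?_, hΓ⟩, .atom γ, ?_⟩
  · rw [phiEx_single_iff]
    simpa using dexBar_arrows_iff.mpr ⟨has, .atom γ⟩
  · rw [ctxWeight_add, ctxWeight_single, Ty.bagWeight_singleton, Ty.weight_arrows, h.length_eq,
      Ty.weight_atom, Ty.weight_atom]
    simp only [Bool.not_false, Bool.false_eq_true, if_true, if_false]
    omega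

/-! ### 1-typings -/

theorem Bounded.lam {u : Term V} {m N : ℕ} (x : V) (h : Bounded (sem u : Sem V A) m N) :
    Bounded (sem (.lam x u) : Sem V A) (m + 1) (N + 1) := by
  refine ⟨by omega, ?_⟩
  rintro _ _ _ ⟨α, Γ, n, hu, rfl, rfl, rfl⟩ hΓ hα
  obtain ⟨ha, hα⟩ := dex_arrow_iff.mp hα
  obtain ⟨b1, b2, b3⟩ := h.2 _ _ _ hu (phiEx_erase_iff.mpr ⟨hΓ, ha⟩) hα
  have := ctxWeight_erase_add Γ x
  rw [Ty.weight_arrow, Bool.not_true]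
  exact ⟨by omega, by omega, fun h => by have := b3 (by omega); omega⟩

theorem Bounded.appList_var {us : List (Term V)} {l : List (ℕ × ℕ)} (x : V)
    (h : List.Forall₂ (fun P p => Bounded (P : Sem V A) p.1 p.2) (us.map sem) l) :
    Bounded (sem (Term.appList (.var x) us) : Sem V A) ((l.map Prod.fst).sum + us.length + 1)
      ((l.map Prod.snd).sum + us.length + 1) := by
  refine ⟨by omega, ?_⟩
  intro α Γ n hn hΓ hα
  obtain ⟨k, rfl, hk⟩ := sem_appList.mp hn
  obtain ⟨b1, b2, b3⟩ := (Bounded.apply_var x h).2 _ _ _ hk hΓ hα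
  rw [List.length_map] at b2 b3
  exact ⟨by omega, by omega, fun h => by have := b3 (by omega); omega⟩

theorem args_ofFn {n : ℕ} {Ps : Fin n → Sem V A} {αs : Fin n → Ty A} {Γ : Fin n → Ctx V A}
    {k : Fin n → ℕ} (h : ∀ i, Ps i (αs i) (Γ i) (k i)) :
    Args (List.ofFn Ps) (List.ofFn fun i => {αs i}) (∑ i, Γ i) (∑ i, k i) := by
  induction n with
  | zero => exact .nil
  | succ n ih =>
    rw [List.ofFn_succ, List.ofFn_succ, Fin.sum_univ_succ, Fin.sum_univ_succ]
    exact .cons (Bag.singleton_iff.mpr (h 0)) (ih fun i => h i.succ)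

theorem forall₂_ofFn {α β : Type*} {R : α → β → Prop} {n : ℕ} {f : Fin n → α} {g : Fin n → β}
    (h : ∀ i, R (f i) (g i)) : List.Forall₂ R (List.ofFn f) (List.ofFn g) := by
  induction n with
  | zero => exact .nil
  | succ n ih =>
    rw [List.ofFn_succ, List.ofFn_succ]
    exact .cons (h 0) (ih fun i => h i.succ)

theorem ctxWeight_sum {n : ℕ} (Γ : Fin n → Ctx V A) :
    ctxWeight (∑ i, Γ i) = ∑ i, ctxWeight (Γ i) := by
  induction n with
  | zero => exact ctxWeight_zero
  | succ n ih => rw [Fin.sum_univ_succ, Fin.sum_univ_succ, ctxWeight_add, ih]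

theorem phiEx_sum {n : ℕ} {Γ : Fin n → Ctx V A} (h : ∀ i, PhiEx (Γ i)) : PhiEx (∑ i, Γ i) := by
  induction n with
  | zero => exact phiEx_zero
  | succ n ih =>
    rw [Fin.sum_univ_succ]
    exact phiEx_add_iff.mpr ⟨h 0, ih fun i => h i.succ⟩

/-- A 1-typing of a normal term is derivable, by a derivation whose size is the weight of the
1-typing; this is the least size and weight. -/
theorem OneTypingNF.spec {Γ : Ctx V A} {t : Term V} {α : Ty A} (h : OneTypingNF Γ t α) :
    PhiEx Γ ∧ Dex α ∧ sem t α Γ (ctxWeight Γ + α.weight true) ∧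
      Bounded (sem t : Sem V A) (ctxWeight Γ + α.weight true) (ctxWeight Γ + α.weight true) := by
  induction h with
  | var x γ =>
    have e : ctxWeight (Finsupp.single x {Ty.atom γ}) + (Ty.atom γ).weight true = 1 := by
      rw [ctxWeight_single, Ty.bagWeight_singleton, Ty.weight_atom, Ty.weight_atom]; rfl
    rw [e]
    refine ⟨phiEx_single_iff.mpr (by simpa using .atom γ), .atom γ, ⟨rfl, rfl⟩, ?_⟩
    -- A variable is a head variable with no arguments.
    simpa [Term.appList] using Bounded.appList_var (A := A) (us := []) (l := []) x .nil
  | @lam Γ x t α _ ih =>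
    obtain ⟨h1, h2, h3, h4⟩ := ih
    have e : ctxWeight (Γ.erase x) + (Ty.arrow (Γ x) α).weight true =
        ctxWeight Γ + α.weight true + 1 := by
      rw [Ty.weight_arrow, Bool.not_true, ← ctxWeight_erase_add Γ x]; omega
    obtain ⟨h5, h6⟩ := phiEx_erase_iff.mp h1
    rw [e]
    exact ⟨h5, .arrow _ _ h6 h2, ⟨α, Γ, _, h3, rfl, rfl, rfl⟩, h4.lam x⟩
  | @head n x us Γ αs γ _ ih =>
    have e : ctxWeight (∑ i, Γ i + Finsupp.single x
        {Ty.arrows (List.ofFn fun i => {αs i}) (Ty.atom γ)}) + (Ty.atom γ).weight true =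
        (∑ i, (ctxWeight (Γ i) + (αs i).weight true)) + n + 1 := by
      rw [ctxWeight_add, ctxWeight_sum, ctxWeight_single, Ty.bagWeight_singleton,
        Ty.weight_arrows, Ty.weight_atom, Ty.weight_atom, List.length_ofFn, List.map_ofFn,
        List.sum_ofFn, Finset.sum_add_distrib]
      simp only [Function.comp_def, Bool.not_false, Ty.bagWeight_singleton, Bool.false_eq_true,
        if_true, if_false]
      omega
    rw [e]
    refine ⟨phiEx_add_iff.mpr ⟨phiEx_sum fun i => (ih i).1, ?_⟩, .atom γ, ?_, ?_⟩
    · rw [phiEx_single_iff]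
      simp only [Multiset.mem_singleton, forall_eq, dexBar_arrows_iff]
      refine ⟨?_, .atom γ⟩
      intro a ha
      obtain ⟨i, rfl⟩ := (List.mem_ofFn' _ _).mp ha
      exact ⟨Multiset.singleton_ne_zero _, by simpa using (ih i).2.1⟩
    · refine sem_appList.mpr ⟨(∑ i, (ctxWeight (Γ i) + (αs i).weight true)) + 1,
        by simp; omega, List.ofFn fun i => {αs i}, _, 1, _, _, ⟨rfl, rfl⟩, ?_, add_comm _ _,
        add_comm _ _⟩
      rw [List.map_ofFn]
      exact args_ofFn fun i => (ih i).2.2.1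
    · have := Bounded.appList_var (A := A) (us := List.ofFn us)
        (l := List.ofFn fun i => (ctxWeight (Γ i) + (αs i).weight true,
          ctxWeight (Γ i) + (αs i).weight true)) x (by
          rw [List.map_ofFn]
          exact forall₂_ofFn fun i => (ih i).2.2.2)
      simpa only [List.map_ofFn, List.sum_ofFn, Function.comp_def, List.length_ofFn] using this

/-! ### Normalization of the terms with a judgement in `Φ^ex × D^ex` -/

/-- Non-emptiness of the multisets is what prevents an argument from being left untyped; it drives
both termination proofs. -/
theorem Args.exists_of_mem {Ps : List (Sem V A)} {as : List (Multiset (Ty A))} {Γ : Ctx V A}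
    {n : ℕ} (h : Args Ps as Γ n) (hΓ : PhiEx Γ) (has : ∀ a ∈ as, a ≠ 0 ∧ ∀ β ∈ a, Dex β)
    {P : Sem V A} (hP : P ∈ Ps) : ∃ α Δ k, k ≤ n ∧ P α Δ k ∧ PhiEx Δ ∧ Dex α := by
  induction h with
  | nil => cases hP
  | @cons Q Ps a as Γ Δ n m h1 _ ih =>
    obtain ⟨hΓ, hΔ⟩ := phiEx_add_iff.mp hΓ
    rw [List.forall_mem_cons] at has
    rcases List.mem_cons.mp hP with rfl | hP
    · obtain ⟨β, hβ⟩ := Multiset.exists_mem_of_ne_zero has.1.1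
      obtain ⟨b, rfl⟩ := Multiset.exists_cons_of_mem hβ
      obtain ⟨Γ₁, n₁, _, _, h, _, rfl, rfl⟩ := Bag.cons_iff.mp h1
      exact ⟨β, Γ₁, n₁, by omega, h, (phiEx_add_iff.mp hΓ).1, has.1.2 β hβ⟩
    · obtain ⟨α, Θ, k, hk, r⟩ := ih hΔ has.2 hP
      exact ⟨α, Θ, k, by omega, r⟩

/-- The arguments of a free variable have smaller judgements in `Φ^ex × D^ex`. -/
theorem exists_of_mem_of_apply_var {x : V} {Ps : List (Sem V A)} {α : Ty A} {Γ : Ctx V A} {n : ℕ}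
    (h : Apply (sem (.var x)) Ps α Γ n) (hΓ : PhiEx Γ) {P : Sem V A} (hP : P ∈ Ps) :
    ∃ α Δ k, k < n ∧ P α Δ k ∧ PhiEx Δ ∧ Dex α := by
  obtain ⟨as, _, _, Γ₂, m, ⟨rfl, rfl⟩, h, rfl, rfl⟩ := h
  obtain ⟨hx, hΓ⟩ := phiEx_add_iff.mp hΓ
  obtain ⟨has, -⟩ := dexBar_arrows_iff.mp (phiEx_single_iff.mp hx _ (Multiset.mem_singleton_self _))
  obtain ⟨α, Δ, k, hk, r⟩ := h.exists_of_mem hΓ has hP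
  exact ⟨α, Δ, k, by omega, r⟩

namespace Term

theorem appList_append_singleton (t u : Term V) (us : List (Term V)) :
    t.appList (us ++ [u]) = (t.appList us).app u := by simp [appList]

/-- A term is an abstraction, or a variable or a redex applied to arguments. -/
theorem head_cases (t : Term V) : (∃ x us, t = (var x).appList us) ∨ (∃ x u, t = lam x u) ∨
    ∃ x u v us, t = ((lam x u).app v).appList us := by
  induction t with
  | var x => exact .inl ⟨x, [], rfl⟩
  | lam x u => exact .inr (.inl ⟨x, u, rfl⟩)
  | app v u ih _ =>
    rcases ih with ⟨x, us, rfl⟩ | ⟨x, w, rfl⟩ | ⟨x, w, v, us, rfl⟩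
    · exact .inl ⟨x, us ++ [u], (appList_append_singleton _ _ _).symm⟩
    · exact .inr (.inr ⟨x, w, u, [], rfl⟩)
    · exact .inr (.inr ⟨x, w, v, us ++ [u], (appList_append_singleton _ _ _).symm⟩)

variable [DecidableEq V] [Infinite V]

theorem Beta.appList {t t' : Term V} (h : Beta t t') (us : List (Term V)) :
    Beta (t.appList us) (t'.appList us) := by
  induction us generalizing t t' with
  | nil => exact h
  | cons u us ih => exact ih (h.appLeft u)

theorem IsNormalFormOf.lam {n u : Term V} (h : IsNormalFormOf n u) (x : V) :
    IsNormalFormOf (lam x n) (lam x u) := by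
  refine ⟨h.1.lift _ fun _ _ h => h.lam x, ?_⟩
  rintro _ (_ | _ | _ | ⟨_, h'⟩)
  exact h.2 _ h'

theorem IsNormalFormOf.app {n n' t u : Term V} (h : IsNormalFormOf n t)
    (hn : ∀ x w, n ≠ .lam x w) (h' : IsNormalFormOf n' u) :
    IsNormalFormOf (n.app n') (t.app u) := by
  refine ⟨(h.1.lift (fun t => t.app u) fun _ _ h => h.appLeft u).trans
    (h'.1.lift (fun u => n.app u) fun _ _ h => h.appRight n), fun m hm => ?_⟩
  cases hm with
  | redex x w => exact hn x w rfl
  | appLeft _ hm => exact h.2 _ hm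
  | appRight _ hm => exact h'.2 _ hm

theorem IsNormalFormOf.appList {ns us : List (Term V)} (h' : List.Forall₂ IsNormalFormOf ns us) :
    ∀ {n t : Term V}, IsNormalFormOf n t → (∀ x w, n ≠ .lam x w) →
      IsNormalFormOf (n.appList ns) (t.appList us) := by
  induction h' with
  | nil => intro n t h _; exact h
  | cons h1 _ ih =>
    intro n t h hn
    exact ih (h.app hn h1) fun _ _ h => by cases h

theorem isNormalFormOf_var (x : V) : IsNormalFormOf (var x) (var x) :=
  ⟨.refl, fun _ h => by cases h⟩

/-- Contracting a head redex lowers the size, and the body of an abstraction or the arguments of a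
head variable have smaller judgements that are again in Φ^ex × D^ex. -/
theorem normalizable_of_sem {n : ℕ} {t : Term V} {α : Ty A} {Γ : Ctx V A} (h : sem t α Γ n)
    (hΓ : PhiEx Γ) (hα : Dex α) : t.Normalizable := by
  induction n using Nat.strong_induction_on generalizing t α Γ with
  | _ n ih =>
    rcases head_cases t with ⟨x, us, rfl⟩ | ⟨x, u, rfl⟩ | ⟨x, u, v, us, rfl⟩
    · obtain ⟨m, rfl, h'⟩ := sem_appList.mp h
      have H : ∀ u ∈ us, ∃ n, IsNormalFormOf n u := fun u hu => by
        obtain ⟨β, Δ, k, hk, hu', hΔ, hβ⟩ :=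
          exists_of_mem_of_apply_var h' hΓ (List.mem_map_of_mem hu)
        exact ih k (by omega) hu' hΔ hβ
      have H' : ∃ ns, List.Forall₂ IsNormalFormOf ns us := by
        clear h h' ih
        induction us with
        | nil => exact ⟨[], .nil⟩
        | cons u us ih' =>
          rw [List.forall_mem_cons] at H
          obtain ⟨⟨n, hn⟩, H⟩ := H
          obtain ⟨ns, hns⟩ := ih' H
          exact ⟨n :: ns, .cons hn hns⟩
      obtain ⟨ns, hns⟩ := H'
      exact ⟨_, .appList hns (isNormalFormOf_var x) fun _ _ h => by cases h⟩
    · obtain ⟨β, Γ', m, hu, rfl, rfl, rfl⟩ := h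
      obtain ⟨ha, hβ⟩ := dex_arrow_iff.mp hα
      obtain ⟨n, hn⟩ := ih m (by omega) hu (phiEx_erase_iff.mpr ⟨hΓ, ha⟩) hβ
      exact ⟨_, hn.lam x⟩
    · obtain ⟨m, rfl, as, Γ₁, k, Γ₂, l, h1, h2, rfl, rfl⟩ := sem_appList.mp h
      obtain ⟨k', hk', h1⟩ := exists_sem_subst h1
      obtain ⟨n, hn⟩ := ih (k' + l + us.length) (by omega)
        (sem_appList.mpr ⟨_, rfl, as, _, _, _, _, h1, h2, rfl, rfl⟩) hΓ hα
      exact ⟨n, hn.1.head ((Beta.redex x u v).appList us), hn.2⟩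

/-- Normal terms have 1-typings. -/
theorem exists_oneTypingNF [Nonempty A] {t : Term V} (h : ∀ t', ¬ Beta t t') :
    (∃ (Γ : Ctx V A) (α : Ty A), OneTypingNF Γ t α) ∧ ((∃ x u, t = lam x u) ∨
      ∃ x us, t = (var x).appList us ∧
        ∀ u ∈ us, ∃ (Γ : Ctx V A) (α : Ty A), OneTypingNF Γ u α) := by
  have γ : A := Classical.arbitrary A
  induction t with
  | var x => exact ⟨⟨_, _, .var x γ⟩, .inr ⟨x, [], rfl, by simp⟩⟩
  | lam x u ih =>
    obtain ⟨⟨Γ, α, hu⟩, -⟩ := ih fun t' h' => h _ (h'.lam x)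
    exact ⟨⟨_, _, .lam x hu⟩, .inl ⟨x, u, rfl⟩⟩
  | app v u ihv ihu =>
    obtain ⟨hu, -⟩ := ihu fun t' h' => h _ (h'.appRight v)
    -- The 1-typing of `v` itself is useless here: the head rule types all arguments at once, so the
    -- second conjunct supplies 1-typings of the earlier arguments one by one.
    rcases (ihv fun t' h' => h _ (h'.appLeft u)).2 with ⟨x, w, rfl⟩ | ⟨x, us, rfl, hus⟩
    · exact absurd (Beta.redex x w u) (h _)
    · have H : ∀ w ∈ us ++ [u], ∃ (Γ : Ctx V A) (α : Ty A), OneTypingNF Γ w α := by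
        intro w hw
        rcases List.mem_append.mp hw with hw | hw
        · exact hus w hw
        · rwa [List.mem_singleton.mp hw]
      rw [← appList_append_singleton]
      refine ⟨?_, .inr ⟨x, _, rfl, H⟩⟩
      choose Γ α H' using fun i : Fin (us ++ [u]).length => H _ (List.get_mem _ i)
      have := OneTypingNF.head x _ Γ α γ H'
      rw [List.ofFn_get] at this
      exact ⟨_, _, this⟩

end Term

/-! ### The semantics of closures and states -/

/-- The judgements of a closure. -/
def csem [DecidableEq V] : Closure V → Sem V A
  | .mk t dom val => Comp (sem t) fun x => if h : x ∈ dom then csem (val ⟨x, h⟩) else freeSem x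

/-- The judgements of the values of an environment. -/
def esem [DecidableEq V] (dom : Finset V) (val : dom → Closure V) (x : V) : Sem V A :=
  if h : x ∈ dom then csem (val ⟨x, h⟩) else freeSem x

/-- The judgements of a state. -/
def ssem [DecidableEq V] (s : State V) : Sem V A := Apply (csem s.1) (s.2.map csem)

/-- The binders of the term of a closure are distinct and not in the domain of its environment;
the same holds for the closures in the environment. -/
def Closure.Good : Closure V → Prop
  | .mk t dom val => t.binders.Nodup ∧ (∀ x ∈ dom, x ∉ t.binders) ∧ ∀ x, Good (val x)

/-- All closures of a state are good. -/
def GoodState (s : State V) : Prop := s.1.Good ∧ ∀ c ∈ s.2, c.Good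

section Machine

variable [DecidableEq V] {dom : Finset V} {val : dom → Closure V} {x : V} {t u : Term V}
  {c : Closure V} {π : List (Closure V)} {α τ : Ty A} {Γ : Ctx V A} {n m N : ℕ}

theorem csem_mk : (csem (.mk t dom val) : Sem V A) = Comp (sem t) (esem dom val) := by
  rw [csem]; rfl

theorem ssem_nil : (ssem (c, []) : Sem V A) = csem c := apply_nil

theorem csem_close_empty : (csem (close t Env.empty) : Sem V A) = sem t := by
  have e : (esem (Env.empty : Env V).dom Env.empty.val : V → Sem V A) = freeSem := by
    ext1 x
    exact dif_neg (Finset.notMem_empty x)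
  rw [close, csem_mk, e, comp_freeSem]

/-- The new value overrides any older one, so this holds without freshness of `x`. -/
theorem esem_extend (e : Env V) :
    (esem (e.extend x c).dom (e.extend x c).val : V → Sem V A) =
      Function.update (esem e.dom e.val) x (csem c) := by
  ext1 y
  by_cases hy : y = x
  · subst hy
    simp [esem, Env.extend]
  · simp [esem, Env.extend, hy]

theorem csem_var_of_mem (hx : x ∈ dom) : csem (.mk (.var x) dom val) α Γ n ↔
    ∃ k, n = k + 1 ∧ csem (val ⟨x, hx⟩) α Γ k := by
  rw [csem_mk, comp_var, esem, dif_pos hx]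

theorem csem_var_of_notMem (hx : x ∉ dom) :
    (csem (.mk (.var x) dom val) : Sem V A) = sem (.var x) := by
  ext α Γ n
  rw [csem_mk, comp_var, esem, dif_neg hx]
  simp [freeSem, sem, and_left_comm, and_comm]

theorem csem_app : csem (.mk (.app t u) dom val) α Γ n ↔ ∃ k, n = k + 1 ∧ ∃ a Γ₁ n₁ Γ₂ n₂,
    csem (.mk t dom val) (Ty.arrow a α) Γ₁ n₁ ∧ Bag (csem (.mk u dom val)) a Γ₂ n₂ ∧
      Γ = Γ₁ + Γ₂ ∧ k = n₁ + n₂ := by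
  simp only [csem_mk, comp_app]
  constructor
  · rintro ⟨a, _, _, _, _, h1, h2, rfl, rfl⟩
    exact ⟨_, rfl, a, _, _, _, _, h1, h2, rfl, rfl⟩
  · rintro ⟨_, rfl, a, _, _, _, _, h1, h2, rfl, rfl⟩
    exact ⟨a, _, _, _, _, h1, h2, rfl, rfl⟩

theorem csem_lam_extend : (∃ a Γ₁ n₁ Γ₂ n₂, csem (.mk (.lam x u) dom val) (Ty.arrow a α) Γ₁ n₁ ∧
    Bag (csem c) a Γ₂ n₂ ∧ Γ = Γ₁ + Γ₂ ∧ n = n₁ + n₂) ↔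
      ∃ k, n = k + 1 ∧ csem (close u ((Env.mk dom val).extend x c)) α Γ k := by
  simp only [close, csem_mk, comp_lam, esem_extend, comp_update]
  constructor
  · rintro ⟨_, _, _, _, _, ⟨β, Γ', m, k, h1, h2, h, rfl⟩, h3, rfl, rfl⟩
    obtain ⟨rfl, rfl⟩ := Ty.arrow_injective h
    exact ⟨_, by omega, Γ', m, _, k, _, _, h1, h2, h3, rfl, rfl⟩
  · rintro ⟨_, rfl, Γ', m, _, k, _, _, h1, h2, h3, rfl, rfl⟩
    exact ⟨_, _, _, _, _, ⟨α, Γ', m, k, h1, h2, rfl, rfl⟩, h3, rfl, by omega⟩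

/-- Outside the domain, the declarations of `x` made by `u` pass through the environment unchanged
and at no cost, so they can be separated from the rest and discharged by an abstraction. -/
theorem csem_of_notMem (hx : x ∉ dom) : csem (.mk u dom val) α Γ n ↔ ∃ Γ' m Γ₁ k,
    sem u α Γ' m ∧ Env.Sat (esem dom val) (Γ'.erase x) Γ₁ k ∧ Γ = Γ₁ + Finsupp.single x (Γ' x) ∧
      n = m + k := by
  have e : (esem dom val : V → Sem V A) = Function.update (esem dom val) x (freeSem x) := by
    rw [Function.eq_update_iff]
    exact ⟨dif_neg hx, fun _ _ => rfl⟩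
  rw [csem_mk, e, comp_update]
  simp only [bag_freeSem, ← e]
  constructor
  · rintro ⟨Γ', m, Γ₁, k, _, _, h1, h2, ⟨rfl, rfl⟩, rfl, rfl⟩
    exact ⟨Γ', m, Γ₁, k, h1, h2, rfl, rfl⟩
  · rintro ⟨Γ', m, Γ₁, k, h1, h2, rfl, rfl⟩
    exact ⟨Γ', m, Γ₁, k, _, _, h1, h2, ⟨rfl, rfl⟩, rfl, rfl⟩

theorem exists_csem_body (hx : x ∉ dom) (h : csem (.mk (.lam x u) dom val) τ Γ n) :
    ∃ a α m, τ = Ty.arrow a α ∧ n = m + 1 ∧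
      csem (.mk u dom val) α (Γ + Finsupp.single x a) m := by
  rw [csem_mk, comp_lam] at h
  obtain ⟨α, Γ', m, k, h1, h2, rfl, rfl⟩ := h
  exact ⟨_, α, m + k, rfl, rfl, (csem_of_notMem hx).mpr ⟨Γ', m, Γ, k, h1, h2, rfl, rfl⟩⟩

/-- Only the declarations of `x` that come from `u` are discharged; `Δ` may still declare `x`
through the values of the environment. Such a clash of names is harmless, since weights are additive
and membership in Φ^ex is checked on each summand. -/
theorem exists_csem_lam (hx : x ∉ dom) (h : csem (.mk u dom val) α Γ n) :
    ∃ a Δ, Γ = Δ + Finsupp.single x a ∧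
      csem (.mk (.lam x u) dom val) (Ty.arrow a α) Δ (n + 1) := by
  obtain ⟨Γ', m, Γ₁, k, h1, h2, rfl, rfl⟩ := (csem_of_notMem hx).mp h
  refine ⟨_, Γ₁, rfl, ?_⟩
  rw [csem_mk, comp_lam]
  exact ⟨α, Γ', m, k, h1, h2, rfl, rfl⟩

theorem Bounded.csem_lam (hx : x ∉ dom) (h : Bounded (csem (.mk u dom val) : Sem V A) m N) :
    Bounded (csem (.mk (.lam x u) dom val) : Sem V A) (m + 1) (N + 1) := by
  refine ⟨by omega, fun τ Γ n hn hΓ hτ => ?_⟩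
  obtain ⟨a, α, k, rfl, rfl, hk⟩ := exists_csem_body hx hn
  obtain ⟨ha, hα⟩ := dex_arrow_iff.mp hτ
  obtain ⟨b1, b2, b3⟩ := h.2 _ _ _ hk (phiEx_add_iff.mpr ⟨hΓ, phiEx_single_iff.mpr ha⟩) hα
  rw [ctxWeight_add, ctxWeight_single] at b2 b3
  rw [Ty.weight_arrow, Bool.not_true]
  exact ⟨by omega, by omega, fun h => by have := b3 (by omega); omega⟩

theorem Attained.csem_lam (hx : x ∉ dom) (h : Attained (csem (.mk u dom val) : Sem V A) m N) :
    Attained (csem (.mk (.lam x u) dom val) : Sem V A) (m + 1) (N + 1) := by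
  obtain ⟨α, _, h, hΓ, hα, hw⟩ := h
  obtain ⟨a, Δ, rfl, h'⟩ := exists_csem_lam hx h
  obtain ⟨hΔ, ha⟩ := phiEx_add_iff.mp hΓ
  refine ⟨_, Δ, h', hΔ, .arrow _ _ (phiEx_single_iff.mp ha) hα, ?_⟩
  rw [ctxWeight_add, ctxWeight_single] at hw
  rw [Ty.weight_arrow, Bool.not_true]
  omega

/-- A step between states lowers the size of the judgements by one. -/
theorem ssem_step {s s' : State V} (h : stepState s = some s') :
    ssem s α Γ n ↔ ∃ k, n = k + 1 ∧ ssem s' α Γ k := by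
  obtain ⟨⟨t, dom, val⟩, π⟩ := s
  cases t with
  | var x =>
    by_cases hx : x ∈ dom
    · obtain rfl : (val ⟨x, hx⟩, π) = s' := by simpa [stepState, Env.lookup, hx] using h
      exact apply_congr_succ fun α Γ n => csem_var_of_mem hx (α := α) (Γ := Γ) (n := n)
    · simp [stepState, Env.lookup, hx] at h
  | app v u =>
    obtain rfl : (Closure.mk v dom val, Closure.mk u dom val :: π) = s' := by
      simpa [stepState] using h
    simp only [ssem, List.map_cons, apply_cons]
    exact apply_congr_succ fun α Γ n => csem_app (α := α) (Γ := Γ) (n := n)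
  | lam x u =>
    cases π with
    | nil => simp [stepState] at h
    | cons c π =>
      obtain rfl : (close u ((Env.mk dom val).extend x c), π) = s' := by
        simpa [stepState] using h
      simp only [ssem, List.map_cons, apply_cons]
      exact apply_congr_succ fun α Γ n => csem_lam_extend (x := x) (u := u) (α := α) (Γ := Γ) (n := n)

theorem Bounded.step {s s' : State V} (h : stepState s = some s')
    (hs : Bounded (ssem s' : Sem V A) m N) : Bounded (ssem s : Sem V A) (m + 1) N := by
  refine ⟨hs.1, fun α Γ n hn hΓ hα => ?_⟩
  obtain ⟨k, rfl, hk⟩ := (ssem_step h).mp hn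
  obtain ⟨b1, b2, b3⟩ := hs.2 _ _ _ hk hΓ hα
  exact ⟨by omega, b2, fun h => by have := b3 h; omega⟩

theorem Attained.step {s s' : State V} (h : stepState s = some s')
    (hs : Attained (ssem s' : Sem V A) m N) : Attained (ssem s : Sem V A) (m + 1) N := by
  obtain ⟨α, Γ, hk, r⟩ := hs
  exact ⟨α, Γ, (ssem_step h).mpr ⟨m, rfl, hk⟩, r⟩

/-- When an argument is popped, `x` enters the domain, and it is not bound again in the body because
the binders are distinct. -/
theorem goodState_step {s s' : State V} (hs : GoodState s) (h : stepState s = some s') :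
    GoodState s' := by
  obtain ⟨⟨t, dom, val⟩, π⟩ := s
  obtain ⟨⟨h1, h2, h3⟩, h4⟩ := hs
  cases t with
  | var x =>
    by_cases hx : x ∈ dom
    · obtain rfl : (val ⟨x, hx⟩, π) = s' := by simpa [stepState, Env.lookup, hx] using h
      exact ⟨h3 _, h4⟩
    · simp [stepState, Env.lookup, hx] at h
  | app v u =>
    obtain rfl : (Closure.mk v dom val, Closure.mk u dom val :: π) = s' := by
      simpa [stepState] using h
    rw [Term.binders, List.nodup_append] at h1
    simp only [Term.binders, List.mem_append, not_or] at h2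
    refine ⟨⟨h1.1, fun x hx => (h2 x hx).1, h3⟩, ?_⟩
    rw [List.forall_mem_cons]
    exact ⟨⟨h1.2.1, fun x hx => (h2 x hx).2, h3⟩, h4⟩
  | lam x u =>
    cases π with
    | nil => simp [stepState] at h
    | cons c π =>
      obtain rfl : (close u ((Env.mk dom val).extend x c), π) = s' := by
        simpa [stepState] using h
      rw [List.forall_mem_cons] at h4
      rw [Term.binders, List.nodup_cons] at h1
      simp only [Term.binders, List.mem_cons, not_or] at h2
      refine ⟨⟨h1.2, ?_, ?_⟩, h4.2⟩
      · intro y hy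
        rcases Finset.mem_insert.mp hy with rfl | hy
        · exact h1.1
        · exact (h2 y hy).2
      · intro y
        simp only [Env.extend]
        split
        · exact h4.1
        · exact h3 _

end Machine

/-! ### Complete executions -/

/-- The number of nodes of a configuration without states. -/
def Conf.nodes : Conf V → ℕ
  | .state _ => 0
  | .var _ => 1
  | .app v u => v.nodes + u.nodes + 1
  | .lam _ k => k.nodes + 1

/-- From `k` the machine stops after `m` steps, at a configuration with `N` nodes. -/
inductive Run [DecidableEq V] : Conf V → ℕ → ℕ → Prop
  | halt {k : Conf V} : stepBeta k = none → Run k 0 k.nodes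
  | step {k k' : Conf V} {m N : ℕ} : stepBeta k = some k' → Run k' m N → Run k (m + 1) N

section Run

variable [DecidableEq V] {k k' : Conf V} {m N : ℕ}

theorem run_step (h : stepBeta k = some k') :
    Run k m N ↔ ∃ m', m = m' + 1 ∧ Run k' m' N := by
  constructor
  · rintro (h' | ⟨h', r⟩)
    · rw [h] at h'; cases h'
    · rw [h] at h'; cases h'; exact ⟨_, rfl, r⟩
  · rintro ⟨_, rfl, r⟩; exact .step h r

theorem run_halt (h : stepBeta k = none) : Run k m N ↔ m = 0 ∧ N = k.nodes := by
  constructor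
  · rintro (h' | ⟨h', r⟩)
    · exact ⟨rfl, rfl⟩
    · rw [h] at h'; cases h'
  · rintro ⟨rfl, rfl⟩; exact .halt h

theorem Run.unique (h : Run k m N) {m' N' : ℕ} (h' : Run k m' N') : m = m' := by
  induction h generalizing m' with
  | halt hk => exact ((run_halt hk).mp h').1.symm
  | step hk _ ih =>
    obtain ⟨_, rfl, h''⟩ := (run_step hk).mp h'
    rw [ih h'']

theorem haltsIn_iff : HaltsIn k m ↔ ∃ N, Run k m N := by
  induction m generalizing k with
  | zero =>
    constructor
    · rintro ⟨_, h, h'⟩; cases h; exact ⟨_, .halt h'⟩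
    · rintro ⟨_, h⟩; cases h with | halt h => exact ⟨k, rfl, h⟩
  | succ m ih =>
    cases hk : stepBeta k with
    | none =>
      constructor
      · rintro ⟨k', h, _⟩
        -- Once the machine has stopped, the iterated map stays at `none`.
        rw [Function.iterate_succ_apply, Option.bind_some, hk,
          Function.iterate_fixed (by rfl)] at h
        cases h
      · rintro ⟨N, h⟩
        have := ((run_halt hk).mp h).1
        omega
    | some k' =>
      have e : HaltsIn k (m + 1) ↔ HaltsIn k' m := by
        simp only [HaltsIn, Function.iterate_succ_apply, Option.bind_some, hk]
      rw [e, ih]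
      exact exists_congr fun N => by rw [run_step hk]; simp

theorem Run.lBeta_eq (h : Run k m N) : lBeta k = m := by
  have H : ∃ n, HaltsIn k n := ⟨m, haltsIn_iff.mpr ⟨N, h⟩⟩
  obtain ⟨N', h'⟩ := haltsIn_iff.mp H.choose_spec
  rw [lBeta, dif_pos H, h'.unique h]

theorem lBeta_eq_top (h : ∀ m N, ¬ Run k m N) : lBeta k = ⊤ :=
  dif_neg fun ⟨m, hm⟩ => by
    obtain ⟨N, hN⟩ := haltsIn_iff.mp hm
    exact h m N hN

theorem run_lam {y : V} : Run (.lam y k) m N ↔ ∃ N', N = N' + 1 ∧ Run k m N' := by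
  constructor
  · intro h
    generalize hc : Conf.lam y k = c at h
    induction h generalizing k with
    | halt h =>
      subst hc
      exact ⟨_, rfl, .halt (by simpa [stepBeta] using h)⟩
    | step h _ ih =>
      subst hc
      obtain ⟨k', hk, rfl⟩ := Option.map_eq_some_iff.mp h
      obtain ⟨N', rfl, h'⟩ := ih rfl
      exact ⟨N', rfl, .step hk h'⟩
  · rintro ⟨N', rfl, h⟩
    induction h with
    | halt h => exact .halt (k := .lam y _) (by simp [stepBeta, h])
    | step h _ ih => exact .step (by simp [stepBeta, h]) ih

/-- The two parts run one after the other without interaction, so the counts add up; the extra node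
is the application itself. -/
theorem run_app {v u : Conf V} : Run (.app v u) m N ↔ ∃ m₁ N₁ m₂ N₂,
    Run v m₁ N₁ ∧ Run u m₂ N₂ ∧ m = m₁ + m₂ ∧ N = N₁ + N₂ + 1 := by
  constructor
  · intro h
    generalize hc : Conf.app v u = c at h
    induction h generalizing v u with
    | halt h =>
      subst hc
      cases hv : stepBeta v with
      | some v' => simp [stepBeta, hv] at h
      | none => exact ⟨_, _, _, _, .halt hv, .halt (by simpa [stepBeta, hv] using h), rfl, rfl⟩
    | step h _ ih =>
      subst hc
      cases hv : stepBeta v with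
      | some v' =>
        simp only [stepBeta, hv, Option.some.injEq] at h
        obtain ⟨m₁, N₁, m₂, N₂, h1, h2, rfl, rfl⟩ := ih h
        exact ⟨_, _, _, _, .step hv h1, h2, by omega, rfl⟩
      | none =>
        simp only [stepBeta, hv] at h
        obtain ⟨u', hu, h⟩ := Option.map_eq_some_iff.mp h
        obtain ⟨m₁, N₁, m₂, N₂, h1, h2, rfl, rfl⟩ := ih h
        exact ⟨_, _, _, _, h1, .step hu h2, by omega, rfl⟩
  · rintro ⟨m₁, N₁, m₂, N₂, h1, h2, rfl, rfl⟩
    induction h1 with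
    | step hv _ ih =>
      rw [Nat.add_right_comm]
      exact .step (by simp [stepBeta, hv]) ih
    | @halt v hv =>
      rw [Nat.zero_add]
      induction h2 with
      | @halt u hu => exact .halt (k := .app v u) (by simp [stepBeta, hv, hu])
      | step hu _ ih => exact .step (by simp [stepBeta, hv, hu]) ih

theorem run_foldl {π : List (Closure V)} :
    Run (π.foldl (fun k c => .app k (.state (c, []))) k) m N ↔ ∃ m₀ N₀ l, Run k m₀ N₀ ∧
      List.Forall₂ (fun c (p : ℕ × ℕ) => Run (.state (c, [])) p.1 p.2) π l ∧
      m = m₀ + (l.map Prod.fst).sum ∧ N = N₀ + (l.map Prod.snd).sum + π.length := by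
  induction π generalizing k with
  | nil =>
    simp only [List.foldl_nil, List.forall₂_nil_left_iff]
    constructor
    · intro h; exact ⟨m, N, [], h, rfl, rfl, rfl⟩
    · rintro ⟨_, _, _, h, rfl, rfl, rfl⟩; exact h
  | cons c π ih =>
    simp only [List.foldl_cons, ih, run_app]
    constructor
    · rintro ⟨_, _, l, ⟨m₁, N₁, m₂, N₂, h1, h2, rfl, rfl⟩, h3, rfl, rfl⟩
      refine ⟨m₁, N₁, (m₂, N₂) :: l, h1, .cons h2 h3, ?_, ?_⟩
      · simp only [List.map_cons, List.sum_cons]; omega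
      · simp only [List.map_cons, List.sum_cons, List.length_cons]; omega
    · rintro ⟨m₁, N₁, _, h1, h, rfl, rfl⟩
      obtain _ | ⟨h2, h3⟩ := h
      refine ⟨_, _, _, ⟨m₁, N₁, _, _, h1, h2, rfl, rfl⟩, h3, ?_, ?_⟩
      · simp only [List.map_cons, List.sum_cons]; omega
      · simp only [List.map_cons, List.sum_cons, List.length_cons]; omega

theorem run_var {x : V} : Run (.var x) m N ↔ m = 0 ∧ N = 1 := run_halt rfl

end Run

/-- A state has a successor, or is a free variable with its arguments, or an abstraction. -/
theorem state_cases [DecidableEq V] (s : State V) :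
    (∃ s', stepState s = some s' ∧ stepBeta (.state s) = some (.state s')) ∨
    (∃ x dom val π, x ∉ dom ∧ s = (.mk (.var x) dom val, π) ∧ stepBeta (.state s) =
      some (π.foldl (fun k c => .app k (.state (c, []))) (.var x))) ∨
    ∃ x u dom val, s = (.mk (.lam x u) dom val, []) ∧
      stepBeta (.state s) = some (.lam x (.state (.mk u dom val, []))) := by
  cases hs : stepState s with
  | some s' => exact .inl ⟨s', rfl, by simp [stepBeta, hs]⟩
  | none =>
    obtain ⟨⟨t, dom, val⟩, π⟩ := s
    cases t with
    | var x =>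
      refine .inr (.inl ⟨x, dom, val, π, fun hx => ?_, rfl, by simp [stepBeta, hs, output]⟩)
      simp [stepState, Env.lookup, hx] at hs
    | app v u => simp [stepState] at hs
    | lam x u =>
      cases π with
      | cons c π => simp [stepState] at hs
      | nil => exact .inr (.inr ⟨x, u, dom, val, rfl, by simp [stepBeta, hs, output]⟩)

theorem GoodState.nil_of_mem {c d : Closure V} {π : List (Closure V)} (hs : GoodState (c, π))
    (hd : d ∈ π) : GoodState (d, []) := ⟨hs.2 d hd, by simp⟩

theorem GoodState.body {x : V} {u : Term V} {dom : Finset V} {val : dom → Closure V}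
    {π : List (Closure V)} (hs : GoodState (.mk (.lam x u) dom val, π)) :
    x ∉ dom ∧ GoodState (.mk u dom val, []) := by
  obtain ⟨⟨h1, h2, h3⟩, -⟩ := hs
  rw [Term.binders, List.nodup_cons] at h1
  simp only [Term.binders, List.mem_cons, not_or] at h2
  exact ⟨fun hx => (h2 x hx).1 rfl, ⟨h1.2, fun y hy => (h2 y hy).2, h3⟩, by simp⟩

section Execution

variable [DecidableEq V] {s : State V}

/-- The least size of a judgement of a state in `Φ^ex × D^ex` is the number of steps, the least
weight is the number of nodes of the final configuration. -/
theorem Run.bounded_and_attained [Nonempty A] {m N : ℕ} (hs : GoodState s)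
    (h : Run (.state s) m N) :
    Bounded (ssem s : Sem V A) m N ∧ Attained (ssem s : Sem V A) m N := by
  induction m using Nat.strong_induction_on generalizing s N with
  | _ m ih =>
    rcases state_cases s with ⟨s', h1, h2⟩ | ⟨x, dom, val, π, hx, rfl, h2⟩ |
      ⟨x, u, dom, val, rfl, h2⟩
    · obtain ⟨m, rfl, h'⟩ := (run_step h2).mp h
      obtain ⟨hb, ha⟩ := ih m (by omega) (goodState_step hs h1) h'
      exact ⟨hb.step h1, ha.step h1⟩
    · obtain ⟨_, rfl, h'⟩ := (run_step h2).mp h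
      obtain ⟨_, _, l, h0, hl, rfl, rfl⟩ := run_foldl.mp h'
      obtain ⟨rfl, rfl⟩ := run_var.mp h0
      -- The step that puts out the head variable makes each argument's run strictly shorter, so the
      -- induction hypothesis applies to it.
      have hle : ∀ p ∈ l, p.1 < 0 + (l.map Prod.fst).sum + 1 := fun p hp => by
        have := List.single_le_sum (fun _ _ => Nat.zero_le _) _
          (List.mem_map_of_mem (f := Prod.fst) hp)
        omega
      have hπ : ∀ c ∈ π, GoodState (c, []) := fun c hc => hs.nil_of_mem hc
      have H : List.Forall₂ (fun c (p : ℕ × ℕ) => Bounded (csem c : Sem V A) p.1 p.2 ∧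
          Attained (csem c : Sem V A) p.1 p.2) π l := by
        rw [List.forall₂_iff_get] at hl ⊢
        refine ⟨hl.1, fun i h1 h2 => ?_⟩
        have := ih _ (hle _ (List.get_mem l ⟨i, h2⟩)) (hπ _ (List.get_mem π ⟨i, h1⟩))
          (hl.2 i h1 h2)
        rwa [ssem_nil] at this
      have e1 : 0 + (l.map Prod.fst).sum + 1 = (l.map Prod.fst).sum + 1 := by omega
      have e2 : 1 + (l.map Prod.snd).sum + π.length =
          (l.map Prod.snd).sum + (π.map (csem (A := A))).length + 1 := by
        rw [List.length_map]; omega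
      rw [ssem, csem_var_of_notMem hx, e1, e2]
      exact ⟨.apply_var x (List.forall₂_map_left_iff.mpr (H.imp fun _ _ h => h.1)),
        .apply_var x (List.forall₂_map_left_iff.mpr (H.imp fun _ _ h => h.2))⟩
    · obtain ⟨m, rfl, h'⟩ := (run_step h2).mp h
      obtain ⟨N, rfl, h''⟩ := run_lam.mp h'
      obtain ⟨hx, hs'⟩ := hs.body
      have := ih m (by omega) hs' h''
      rw [ssem_nil] at this ⊢
      exact ⟨this.1.csem_lam hx, this.2.csem_lam hx⟩

theorem exists_run_of_ssem {n : ℕ} {α : Ty A} {Γ : Ctx V A} (hs : GoodState s)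
    (h : ssem s α Γ n) (hΓ : PhiEx Γ) (hα : Dex α) : ∃ m N, Run (.state s) m N := by
  induction n using Nat.strong_induction_on generalizing s α Γ with
  | _ n ih =>
    rcases state_cases s with ⟨s', h1, h2⟩ | ⟨x, dom, val, π, hx, rfl, h2⟩ |
      ⟨x, u, dom, val, rfl, h2⟩
    · obtain ⟨k, rfl, h'⟩ := (ssem_step h1).mp h
      obtain ⟨m, N, r⟩ := ih k (by omega) (goodState_step hs h1) h' hΓ hα
      exact ⟨_, _, .step h2 r⟩
    · rw [ssem, csem_var_of_notMem hx] at h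
      have H : ∀ c ∈ π, ∃ m N, Run (.state (c, [])) m N := fun c hc => by
        obtain ⟨β, Δ, k, hk, h', hΔ, hβ⟩ :=
          exists_of_mem_of_apply_var h hΓ (List.mem_map_of_mem hc)
        exact ih k hk (hs.nil_of_mem hc) (by rwa [ssem_nil]) hΔ hβ
      have H' : ∃ l, List.Forall₂ (fun c (p : ℕ × ℕ) => Run (.state (c, [])) p.1 p.2) π l := by
        clear h h2 hs
        induction π with
        | nil => exact ⟨[], .nil⟩
        | cons c π ih' =>
          rw [List.forall_mem_cons] at H
          obtain ⟨⟨m, N, h1⟩, H⟩ := H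
          obtain ⟨l, hl⟩ := ih' H
          exact ⟨(m, N) :: l, .cons h1 hl⟩
      obtain ⟨l, hl⟩ := H'
      exact ⟨_, _, .step h2 (run_foldl.mpr ⟨_, _, l, run_var.mpr ⟨rfl, rfl⟩, hl, rfl, rfl⟩)⟩
    · rw [ssem_nil] at h
      obtain ⟨hx, hs'⟩ := hs.body
      obtain ⟨a, β, k, rfl, rfl, h'⟩ := exists_csem_body hx h
      obtain ⟨ha, hβ⟩ := dex_arrow_iff.mp hα
      obtain ⟨m, N, r⟩ := ih k (by omega) hs' (by rwa [ssem_nil])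
        (phiEx_add_iff.mpr ⟨hΓ, phiEx_single_iff.mpr ha⟩) hβ
      exact ⟨_, _, .step h2 (run_lam.mpr ⟨N, rfl, r⟩)⟩

end Execution

end LambdaR

theorem mainTheorem3 {V : Type*} {A : Type*} [DecidableEq V] [Infinite V] [Nonempty A]
    (t t' : LambdaR.Term V) (hα : LambdaR.Term.AlphaEq t t') (ht : t'.RespectsConvention) :
    LambdaR.lBeta (LambdaR.initial t') = sInf (LambdaR.sizesEx A t) ∧
    (¬ t.Normalizable →
      LambdaR.lBeta (LambdaR.initial t') = ⊤ ∧ sInf (LambdaR.sizesEx A t) = ⊤) ∧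
    (t.Normalizable →
      (∃ (Γ : LambdaR.Ctx V A) (α : LambdaR.Ty A), LambdaR.OneTyping Γ t α) ∧
      ∀ (Γ : LambdaR.Ctx V A) (α : LambdaR.Ty A), LambdaR.OneTyping Γ t α →
        LambdaR.PhiEx Γ ∧ LambdaR.Dex α ∧ Nonempty (LambdaR.Deriv Γ t α) ∧
        ∀ d : LambdaR.Deriv Γ t α, (d.size : ℕ∞) = LambdaR.lBeta (LambdaR.initial t')) := by
  open LambdaR in
  have hsem : (ssem (close t' Env.empty, []) : Sem V A) = sem t := by
    rw [ssem_nil, csem_close_empty, sem_eq_of_alphaEq hα]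
  have hgood : GoodState (close t' Env.empty, []) :=
    ⟨⟨ht, fun x hx => absurd hx (Finset.notMem_empty x),
      fun x => absurd x.2 (Finset.notMem_empty _)⟩, by simp⟩
  have hrun : ∀ {m N}, Run (initial t') m N →
      Bounded (sem t : Sem V A) m N ∧ Attained (sem t : Sem V A) m N := fun h =>
    hsem ▸ h.bounded_and_attained hgood
  have hex : ∀ {α : Ty A} {Γ n}, sem t α Γ n → PhiEx Γ → Dex α → ∃ m N, Run (initial t') m N :=
    fun h => exists_run_of_ssem hgood (hsem ▸ h)
  have hinf : lBeta (initial t') = sInf (sizesEx A t) := by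
    by_cases H : ∃ m N, Run (initial t') m N
    · obtain ⟨m, N, h⟩ := H
      obtain ⟨hb, α, Γ, h', hΓ, hα, -⟩ := hrun h
      rw [h.lBeta_eq]
      refine le_antisymm (le_sInf ?_) (sInf_le ?_)
      · rintro _ ⟨Γ, α, d, hΓ, hα, rfl⟩
        exact_mod_cast (hb.2 _ _ _ d.sem_size hΓ hα).1
      · obtain ⟨d, rfl⟩ := sem_iff.mp h'
        exact ⟨Γ, α, d, hΓ, hα, rfl⟩
    · rw [lBeta_eq_top fun m N h => H ⟨m, N, h⟩, eq_comm, sInf_eq_top]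
      rintro _ ⟨Γ, α, d, hΓ, hα, rfl⟩
      exact absurd (hex d.sem_size hΓ hα) H
  refine ⟨hinf, fun hn => ?_, fun hn => ⟨?_, ?_⟩⟩
  · have : lBeta (initial t') = ⊤ := lBeta_eq_top fun m N h => by
      obtain ⟨-, α, Γ, h', hΓ, hα, -⟩ := hrun h
      exact hn (Term.normalizable_of_sem h' hΓ hα)
    exact ⟨this, hinf ▸ this⟩
  · obtain ⟨n, hn⟩ := hn
    obtain ⟨⟨Γ, α, h⟩, -⟩ := Term.exists_oneTypingNF (A := A) hn.2
    exact ⟨Γ, α, n, hn, h⟩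
  · rintro Γ α ⟨n, hn, h⟩
    obtain ⟨hΓ, hα, h1, h2⟩ := h.spec
    obtain ⟨k, hk⟩ := (typable_iff_of_normalForm hn).mpr ⟨_, h1⟩
    obtain ⟨m, N, hr⟩ := hex hk hΓ hα
    obtain ⟨hb, β, Δ, h3, hΔ, hβ, hw⟩ := hrun hr
    -- The judgement of weight `N` attained by `t` also holds for the normal form, where the
    -- 1-typing has least weight. So the weight of the 1-typing is at most `N`, and the last clause
    -- of `Bounded` for `t` fixes the size of its derivations.
    obtain ⟨j, hj⟩ := (typable_iff_of_normalForm hn).mp ⟨_, h3⟩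
    have hle := (h2.2 _ _ _ hj hΔ hβ).2.1
    obtain ⟨d, -⟩ := sem_iff.mp hk
    refine ⟨hΓ, hα, ⟨d⟩, fun d => ?_⟩
    obtain ⟨b1, -, b3⟩ := hb.2 _ _ _ d.sem_size hΓ hα
    rw [hr.lBeta_eq, le_antisymm (b3 (hle.trans hw.le)) b1]
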